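/- For a dyadic interval $J=[j2^{-k},(j+1)2^{-k})$ let $h_J=-\mathbf 1_{J_{\rm left}}+\mathbf 1_{J_{\rm right}}$, and for a dyadic rectangle $R=R_1\times R_2\times R_3\subset[0,1)^3$ let $h_R(x)=\prod_{k=1}^3 h_{R_k}(x_k)$. For $\vec r\in\{0,1,2,\dots\}^3$, an $\mathsf r$-function with parameter $\vec r$ is a function $\sum_R\varepsilon_R h_R$ with arbitrary signs $\varepsilon_R\in\{\pm1\}$, the sum being over all dyadic rectangles $R\subset[0,1)^3$ with $|R_k|=2^{-r_k}$, $k=1,2,3$. Let $\mathbb H_n$ be the set of $\vec r\in\{0,1,2,\dots\}^3$ with $r_1+r_2+r_3=n$. Norms and probabilities are with respect to Lebesgue measure on $[0,1]^3$. There are absolute constants $0<c<1$ and $K>0$ such that the following holds for all integers $n\ge1$ and $1\le q\le n^{1/3}$ (in particular for $q=\lfloor a n^{\varepsilon}\rfloor\ge1$ with $0<a\le1$, $0<\varepsilon\le 1/3$). Divide $\{1,\dots,n\}$ into $q$ disjoint intervals $I_1,\dots,I_q$ of integers, each of length $n/q$ up to rounding (that is, of cardinality $\lfloor n/q\rfloor$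 or $\lfloor n/q\rfloor+1$), for each $\vec r\in\mathbb H_n$ let $f_{\vec r}$ be an $\mathsf r$-function with parameter $\vec r$, and put $$F_t=\sum_{\vec r\in\mathbb H_n,\ r_1\in I_t} f_{\vec r},\qquad \rho=\frac{\sqrt q}{n}.$$ Then for every $1\le t\le q$, $$\|\rho F_t\|_p\le K\sqrt p\qquad\text{for all real } 1\le p\le c\,n^{1/3},$$ and $$\mathbb P(\rho F_t>x)\le K\exp(-c x^2)\qquad\text{for all } 0\le x<c\,n^{1/6}.$$ -/

import Mathlib

open MeasureTheory

noncomputable section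

namespace Hyperbolic

/-- The dyadic interval `[j 2^{-k}, (j+1) 2^{-k})`. -/
def dyadicInterval (k j : ℕ) : Set ℝ :=
  Set.Ico ((j : ℝ) / 2 ^ k) (((j : ℝ) + 1) / 2 ^ k)

/-- The `L^∞`-normalized Haar function `-1_{left half} + 1_{right half}` of `dyadicInterval k j`. -/
def haar (k j : ℕ) (x : ℝ) : ℝ :=
  -(dyadicInterval (k + 1) (2 * j)).indicator 1 x
    + (dyadicInterval (k + 1) (2 * j + 1)).indicator 1 x

/-- The dyadic rectangles `R ⊆ [0,1)^3` with side lengths `2^{-r 0}, 2^{-r 1}, 2^{-r 2}`,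
each given by the positions of its sides. -/
abbrev Rect (r : Fin 3 → ℕ) : Type := (i : Fin 3) → Fin (2 ^ r i)

/-- The Haar function of a rectangle: the tensor product of the Haar functions of its sides. -/
def haarRect (r : Fin 3 → ℕ) (R : Rect r) (x : Fin 3 → ℝ) : ℝ :=
  ∏ i, haar (r i) (R i) (x i)

/-- `f` is an `r`-function with parameter `r`: a sum `∑ ε_R h_R`, with signs `ε_R = ±1`, over all
dyadic rectangles `R ⊆ [0,1)^3` with side lengths `2^{-r i}`. -/
def IsRFunction (r : Fin 3 → ℕ) (f : (Fin 3 → ℝ) → ℝ) : Prop :=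
  ∃ ε : Rect r → ℝ, (∀ R, ε R = 1 ∨ ε R = -1) ∧ ∀ x, f x = ∑ R, ε R * haarRect r R x

/-- The hyperbolic vectors: triples of natural numbers with sum `n`. -/
def hyperbolicVectors (n : ℕ) : Finset (Fin 3 → ℕ) :=
  Finset.Nat.antidiagonalTuple 3 n

/-- `I` divides `{1, …, n}` into `q` disjoint intervals of length `n / q`, up to rounding. -/
structure IsIntervalPartition (n q : ℕ) (I : Fin q → Finset ℕ) : Prop where
  interval : ∀ t, ∃ a b, I t = Finset.Icc a b
  disjoint : ∀ s t, s ≠ t → Disjoint (I s) (I t)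
  cover : Finset.univ.biUnion I = Finset.Icc 1 n
  length : ∀ t, (I t).card = n / q ∨ (I t).card = n / q + 1

/-- The block sum: the sum of `f r` over the hyperbolic vectors `r` with first coordinate in `J`. -/
def blockSum (n : ℕ) (J : Finset ℕ) (f : (Fin 3 → ℕ) → (Fin 3 → ℝ) → ℝ) (x : Fin 3 → ℝ) : ℝ :=
  ∑ r ∈ (hyperbolicVectors n).filter (fun r => r 0 ∈ J), f r x

/-- The true `L^2` normalization `√q / n`. -/
def rho (n q : ℕ) : ℝ := Real.sqrt q / n

/-- Lebesgue measure on the unit cube `[0,1]^3`. -/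
def cubeMeasure : Measure (Fin 3 → ℝ) := volume.restrict (Set.Icc 0 1)

end Hyperbolic

end

noncomputable section

namespace Hyperbolic

open Finset

/-! ### Dyadic martingale differences on `{0, …, 2^N - 1}` -/

/-! Write `G_s = ∑_a f_(s,a,n-s-a)`, so that `F_t = ∑_{s ∈ I_t} G_s`, and let `m = #(I_t)`, `S = ∑
G_s ^ 2`. In each variable separately an `r`-function is the sign of one binary digit times a
function of the earlier digits, that is, a dyadic martingale difference. Each of the three variables
supplies one exponential martingale estimate.

In `x_1` the `G_s` are martingale differences, so `exp (λ F_t - λ² S / 2)` has mean at most `1`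
(`gridSum_exp_sum_rowSum_le`), and `F_t` has a subgaussian tail where `S ≤ V`. The difficulty is the
tail of `S`. For signs `ω_s` put `D_a = ∑_s ω_s f_(s,a,n-s-a)`; these are martingale differences in
`x_2`, so `exp (μ ∑ D_a - μ² ∑ D_a² / 2)` has mean at most `1`, also after averaging over `ω`
(`gridSum_signAverage_le`). Tilting each `ω_s` towards `G_s` in the Gibbs variational principle
bounds this average below by `exp (μ² S / 8 - O(μ² m n))` (`exp_le_signAverage`), so `S` is rarely
large.

The lower bound needs `|G_s| ≤ L` and correlations of distinct rows at most `L`. The first is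
Azuma's inequality in `x_2`. For the second, two rows with the same `a` have different third
indices, so the terms of a correlation are martingale differences in `x_3`, and Azuma applies again.

Balance: a tail `e^{-u}` with `u ≲ n^{1/3}` costs `L² ≈ n^{4/3}` and `V ≈ m n + u (L m + L²)`. As `m
≈ n / q`, this is `O(n² / q)` precisely because `q ≤ n^{1/3}`. Moments also need the tail at higher
levels, so everything carries a parameter `w ≥ 1`. -/

/-- The sign `-1` of an even number and `+1` of an odd number. -/
def digitSign (i : ℕ) : ℝ := if i % 2 = 1 then 1 else -1

lemma digitSign_sq (i : ℕ) : digitSign i ^ 2 = 1 := by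
  unfold digitSign; split_ifs <;> norm_num

lemma abs_digitSign (i : ℕ) : |digitSign i| = 1 := by
  unfold digitSign; split_ifs <;> norm_num

/-- `g` is a martingale difference at the `k`-th of `N` binary digits: the sign of that digit times
a function of the digits before it. -/
def IsDifference (N k : ℕ) (g : ℕ → ℝ) : Prop :=
  ∃ c : ℕ → ℝ, ∀ j, g j = digitSign (j / 2 ^ (N - 1 - k)) * c (j / 2 ^ (N - k))

lemma IsDifference.zero (N k : ℕ) : IsDifference N k (fun _ => 0) :=
  ⟨fun _ => 0, fun j => by simp⟩

lemma IsDifference.const_mul {N k : ℕ} {g : ℕ → ℝ} (hg : IsDifference N k g) (a : ℝ) :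
    IsDifference N k (fun j => a * g j) := by
  obtain ⟨c, hc⟩ := hg
  exact ⟨fun i => a * c i, fun j => by simp only [hc]; ring⟩

lemma IsDifference.sum {ι : Type*} {N k : ℕ} (s : Finset ι) {g : ι → ℕ → ℝ}
    (hg : ∀ i ∈ s, IsDifference N k (g i)) : IsDifference N k (fun j => ∑ i ∈ s, g i j) := by
  choose! c hc using hg
  refine ⟨fun m => ∑ i ∈ s, c i m, fun j => ?_⟩
  rw [Finset.mul_sum]
  exact Finset.sum_congr rfl fun i hi => hc i hi j

/-- A difference at an earlier digit is determined by the digits before the `k`-th. -/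
lemma IsDifference.predictable {N b k : ℕ} {g : ℕ → ℝ} (hg : IsDifference N b g) (hb : b < k)
    (hk : k ≤ N) : ∃ c : ℕ → ℝ, ∀ j, g j = c (j / 2 ^ (N - k)) := by
  obtain ⟨c, hc⟩ := hg
  refine ⟨fun i => digitSign (i / 2 ^ (k - 1 - b)) * c (i / 2 ^ (k - b)), fun j => ?_⟩
  have h1 : N - 1 - b = (N - k) + (k - 1 - b) := by omega
  have h2 : N - b = (N - k) + (k - b) := by omega
  simp only [hc]
  rw [Nat.div_div_eq_div_mul, Nat.div_div_eq_div_mul, ← pow_add, ← pow_add, ← h1, ← h2]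

/-- The earlier factor is frozen once the digits before the `k`-th are known, so it joins the
coefficient. This makes correlations of distinct rows martingales. -/
lemma IsDifference.mul_earlier {N b k : ℕ} {g h : ℕ → ℝ} (hg : IsDifference N k g)
    (hh : IsDifference N b h) (hb : b < k) (hk : k ≤ N) :
    IsDifference N k (fun j => g j * h j) := by
  obtain ⟨c, hc⟩ := hg
  obtain ⟨d, hd⟩ := hh.predictable hb hk
  exact ⟨fun i => c i * d i, fun j => by simp only [hc, hd]; ring⟩

lemma sum_range_two_mul (M : ℕ) (g : ℕ → ℝ) :
    ∑ j ∈ range (2 * M), g j = ∑ i ∈ range M, (g (2 * i) + g (2 * i + 1)) := by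
  induction M with
  | zero => simp
  | succ M ih =>
    rw [show 2 * (M + 1) = 2 * M + 1 + 1 by ring, sum_range_succ, sum_range_succ, ih,
      sum_range_succ]
    ring

lemma exp_add_exp_neg_le (c : ℝ) :
    Real.exp (c - c ^ 2 / 2) + Real.exp (-c - c ^ 2 / 2) ≤ 2 := by
  have h := Real.cosh_le_exp_half_sq c
  rw [Real.cosh_eq] at h
  have h2 : Real.exp (c ^ 2 / 2) * Real.exp (-(c ^ 2 / 2)) = 1 := by
    rw [← Real.exp_add]; simp
  have h3 := Real.exp_pos (-(c ^ 2 / 2))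
  rw [sub_eq_add_neg, sub_eq_add_neg, Real.exp_add, Real.exp_add]
  nlinarith

/-- Induction on the last digit: `2 * i` and `2 * i + 1` share every term except the last
difference, which takes the values `∓ c N i`; then `cosh c ≤ exp (c ^ 2 / 2)` gives the factor `2`.
-/
lemma sum_exp_predictable_le (N : ℕ) (c : ℕ → ℕ → ℝ) :
    ∑ j ∈ range (2 ^ N), Real.exp (∑ k ∈ range N, digitSign (j / 2 ^ (N - 1 - k)) *
      c k (j / 2 ^ (N - k)) - (∑ k ∈ range N, c k (j / 2 ^ (N - k)) ^ 2) / 2) ≤ 2 ^ N := by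
  induction N with
  | zero => simp
  | succ N ih =>
    rw [pow_succ', sum_range_two_mul, pow_succ']
    refine le_trans ?_ (mul_le_mul_of_nonneg_left ih (by norm_num : (0 : ℝ) ≤ 2))
    rw [Finset.mul_sum]
    refine Finset.sum_le_sum fun i _ => ?_
    have key : ∀ j, j / 2 = i → ∀ k ∈ range N,
        j / 2 ^ (N + 1 - 1 - k) = i / 2 ^ (N - 1 - k) ∧ j / 2 ^ (N + 1 - k) = i / 2 ^ (N - k) := by
      intro j hj k hk
      have hk' := Finset.mem_range.1 hk
      rw [show N + 1 - 1 - k = (N - 1 - k) + 1 by omega, show N + 1 - k = (N - k) + 1 by omega,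
        pow_succ', pow_succ', ← Nat.div_div_eq_div_mul, ← Nat.div_div_eq_div_mul, hj]
      exact ⟨rfl, rfl⟩
    have split : ∀ j, j / 2 = i →
        (∑ k ∈ range (N + 1), digitSign (j / 2 ^ (N + 1 - 1 - k)) * c k (j / 2 ^ (N + 1 - k))
          - (∑ k ∈ range (N + 1), c k (j / 2 ^ (N + 1 - k)) ^ 2) / 2)
        = (∑ k ∈ range N, digitSign (i / 2 ^ (N - 1 - k)) * c k (i / 2 ^ (N - k))
          - (∑ k ∈ range N, c k (i / 2 ^ (N - k)) ^ 2) / 2)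
          + (digitSign j * c N i - c N i ^ 2 / 2) := by
      intro j hj
      have e1 : ∑ k ∈ range N, digitSign (j / 2 ^ (N + 1 - 1 - k)) * c k (j / 2 ^ (N + 1 - k))
          = ∑ k ∈ range N, digitSign (i / 2 ^ (N - 1 - k)) * c k (i / 2 ^ (N - k)) :=
        Finset.sum_congr rfl fun k hk => by rw [(key j hj k hk).1, (key j hj k hk).2]
      have e2 : ∑ k ∈ range N, c k (j / 2 ^ (N + 1 - k)) ^ 2
          = ∑ k ∈ range N, c k (i / 2 ^ (N - k)) ^ 2 :=
        Finset.sum_congr rfl fun k hk => by rw [(key j hj k hk).2]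
      rw [sum_range_succ, sum_range_succ, e1, e2]
      simp only [add_tsub_cancel_right, tsub_self, pow_zero, Nat.div_one, add_tsub_cancel_left,
        pow_one, hj]
      ring
    rw [split (2 * i) (by omega), split (2 * i + 1) (by omega), Real.exp_add, Real.exp_add,
      ← mul_add, mul_comm (2 : ℝ)]
    refine mul_le_mul_of_nonneg_left ?_ (Real.exp_pos _).le
    have h0 : digitSign (2 * i) = -1 := by simp [digitSign]
    have h1 : digitSign (2 * i + 1) = 1 := by simp [digitSign, Nat.add_mod]
    rw [h0, h1, add_comm, neg_one_mul, one_mul]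
    exact exp_add_exp_neg_le _

/-- The exponential supermartingale inequality for a dyadic martingale. -/
theorem sum_exp_sub_sq_le {N : ℕ} {D : ℕ → ℕ → ℝ} (hD : ∀ k < N, IsDifference N k (D k)) :
    ∑ j ∈ range (2 ^ N), Real.exp (∑ k ∈ range N, D k j - (∑ k ∈ range N, D k j ^ 2) / 2)
      ≤ 2 ^ N := by
  choose! c hc using hD
  refine le_trans (le_of_eq ?_) (sum_exp_predictable_le N c)
  refine Finset.sum_congr rfl fun j _ => ?_
  congr 2
  · exact Finset.sum_congr rfl fun k hk => hc k (Finset.mem_range.1 hk) j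
  · congr 1
    refine Finset.sum_congr rfl fun k hk => ?_
    rw [hc k (Finset.mem_range.1 hk) j, mul_pow, digitSign_sq, one_mul]

/-- The two-sided exponential weight that exceeds `1` where `L < |x|`. -/
def tailWeight (N : ℕ) (L x : ℝ) : ℝ :=
  Real.exp (-(L ^ 2 / N)) * (Real.exp (L / N * x) + Real.exp (-(L / N * x)))

lemma tailWeight_nonneg (N : ℕ) (L x : ℝ) : 0 ≤ tailWeight N L x := by
  unfold tailWeight; positivity

lemma one_le_tailWeight {N : ℕ} {L x : ℝ} (hL : 0 ≤ L) (hx : L < |x|) :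
    1 ≤ tailWeight N L x := by
  unfold tailWeight
  have h : Real.exp (L / N * |x|) ≤ Real.exp (L / N * x) + Real.exp (-(L / N * x)) := by
    rcases abs_choice x with h | h <;> rw [h]
    · linarith [Real.exp_pos (-(L / N * x))]
    · rw [mul_neg]; linarith [Real.exp_pos (L / N * x)]
  refine le_trans ?_ (mul_le_mul_of_nonneg_left h (Real.exp_pos _).le)
  rw [← Real.exp_add]
  refine Real.one_le_exp ?_
  have : L / N * L ≤ L / N * |x| := mul_le_mul_of_nonneg_left hx.le (by positivity)
  have h2 : L / N * L = L ^ 2 / N := by ring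
  linarith

/-- The subgaussian bound for a dyadic martingale with differences bounded by `1`. -/
theorem sum_tailWeight_le {N : ℕ} (hN : 0 < N) {D : ℕ → ℕ → ℝ}
    (hD : ∀ k < N, IsDifference N k (D k)) (hb : ∀ k j, |D k j| ≤ 1) (L : ℝ) :
    ∑ j ∈ range (2 ^ N), tailWeight N L (∑ k ∈ range N, D k j)
      ≤ 2 ^ N * (2 * Real.exp (-(L ^ 2 / (2 * N)))) := by
  have hN' : (0 : ℝ) < N := by exact_mod_cast hN
  -- The rate `L / N` is the Chernoff optimum: the squares contribute at most `L ^ 2 / (2 * N)`,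
  -- half of what the prefactor `exp (-(L ^ 2 / N))` gains.
  have one : ∀ a : ℝ, a ^ 2 = (L / N) ^ 2 →
      ∑ j ∈ range (2 ^ N), Real.exp (-(L ^ 2 / N)) * Real.exp (a * ∑ k ∈ range N, D k j)
        ≤ 2 ^ N * Real.exp (-(L ^ 2 / (2 * N))) := by
    intro a ha
    have h := sum_exp_sub_sq_le (N := N) (D := fun k j => a * D k j)
      (fun k hk => (hD k hk).const_mul a)
    refine le_trans ?_ (mul_le_mul_of_nonneg_right h (Real.exp_pos _).le)
    rw [Finset.sum_mul]
    refine Finset.sum_le_sum fun j _ => ?_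
    rw [← Real.exp_add, ← Real.exp_add]
    refine Real.exp_le_exp.2 ?_
    rw [Finset.mul_sum]
    have hs : ∑ k ∈ range N, (a * D k j) ^ 2 ≤ L ^ 2 / N := by
      calc ∑ k ∈ range N, (a * D k j) ^ 2 ≤ ∑ k ∈ range N, (L / N) ^ 2 := by
            refine Finset.sum_le_sum fun k _ => ?_
            rw [mul_pow, ha]
            have : D k j ^ 2 ≤ 1 := by
              rw [← sq_abs]; exact pow_le_one₀ (abs_nonneg _) (hb k j)
            nlinarith [sq_nonneg (L / N)]
        _ = L ^ 2 / N := by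
            rw [Finset.sum_const, Finset.card_range, nsmul_eq_mul]; field_simp
    have : L ^ 2 / (2 * N) = L ^ 2 / N / 2 := by field_simp
    rw [this]
    linarith
  have h1 := one (L / N) rfl
  have h2 := one (-(L / N)) (by ring)
  simp only [tailWeight, mul_add, Finset.sum_add_distrib]
  simp only [neg_mul] at h2
  linarith

/-! ### A Gibbs variational lower bound over random signs -/

/-- The sign attached to a Boolean. -/
def boolSign (b : Bool) : ℝ := if b then 1 else -1

lemma boolSign_sq (b : Bool) : boolSign b * boolSign b = 1 := by cases b <;> simp [boolSign]

/-- The product weight on sign vectors with means `h`. -/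
def signWeight {ι : Type*} [Fintype ι] (h : ι → ℝ) (ω : ι → Bool) : ℝ :=
  ∏ i, (1 + h i * boolSign (ω i)) / 2

section Gibbs

variable {ι : Type*} [Fintype ι] [DecidableEq ι]

lemma sum_signWeight_mul_prod (h : ι → ℝ) (φ : ι → Bool → ℝ) :
    ∑ ω : ι → Bool, signWeight h ω * ∏ i, φ i (ω i)
      = ∏ i, ((1 + h i) / 2 * φ i true + (1 - h i) / 2 * φ i false) := by
  have := Finset.prod_univ_sum (fun _ : ι => (Finset.univ : Finset Bool))
    (fun i b => (1 + h i * boolSign b) / 2 * φ i b)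
  simp only [Fintype.univ_bool, Finset.mem_singleton, Bool.true_eq_false, not_false_eq_true,
    Finset.sum_insert, Finset.sum_singleton, boolSign, if_true, mul_one, Bool.false_eq_true,
    if_false, mul_neg, ← sub_eq_add_neg] at this
  rw [this]
  refine Finset.sum_bij (fun ω _ => ω) ?_ (fun _ _ _ _ h => h) (fun ω _ => ⟨ω, by simp, rfl⟩) ?_
  · intro ω _
    simp only [Fintype.mem_piFinset]
    intro i
    cases ω i <;> simp
  · intro ω _
    simp only [signWeight, boolSign, Finset.prod_mul_distrib]

lemma sum_signWeight (h : ι → ℝ) : ∑ ω : ι → Bool, signWeight h ω = 1 := by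
  have := sum_signWeight_mul_prod h (fun _ _ => 1)
  simp only [Finset.prod_const_one, mul_one] at this
  rw [this]
  exact Finset.prod_eq_one fun i _ => by ring

lemma sum_signWeight_mul_sign (h : ι → ℝ) (s : ι) :
    ∑ ω : ι → Bool, signWeight h ω * boolSign (ω s) = h s := by
  have := sum_signWeight_mul_prod h (fun i b => if i = s then boolSign b else 1)
  simp only [Finset.prod_ite_eq', Finset.mem_univ, if_true] at this
  rw [this, Finset.prod_eq_single s]
  · simp [boolSign]; ring
  · intro i _ hi; simp [hi]; ring
  · simp

lemma sum_signWeight_mul_sign_mul_sign (h : ι → ℝ) {s t : ι} (hst : s ≠ t) :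
    ∑ ω : ι → Bool, signWeight h ω * (boolSign (ω s) * boolSign (ω t)) = h s * h t := by
  have := sum_signWeight_mul_prod h
    (fun i b => (if i = s then boolSign b else 1) * (if i = t then boolSign b else 1))
  simp only [Finset.prod_mul_distrib, Finset.prod_ite_eq', Finset.mem_univ, if_true] at this
  rw [this]
  have e : ∀ i, ((1 + h i) / 2 * ((if i = s then boolSign true else 1) *
      (if i = t then boolSign true else 1)) + (1 - h i) / 2 * ((if i = s then boolSign false else 1)
      * (if i = t then boolSign false else 1)))
      = (if i = s then h i else 1) * (if i = t then h i else 1) := by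
    intro i
    by_cases h1 : i = s
    · have h2 : i ≠ t := fun h2 => hst (h1.symm.trans h2)
      simp only [h1, h1 ▸ h2, if_true, if_false, boolSign]; norm_num; ring
    · by_cases h2 : i = t
      · simp only [h2, hst.symm, if_true, if_false, boolSign]; norm_num; ring
      · simp only [h1, h2, if_false]; ring
  simp only [e, Finset.prod_mul_distrib, Finset.prod_ite_eq', Finset.mem_univ, if_true]

/-- Gibbs variational principle: the log of a uniform average dominates the mean under any law minus
its relative entropy. The density of the product law is `∏ (1 + h i * ω i) ≤ exp (∑ h i * ω i)`, so
the entropy is at most `∑ h i ^ 2`; Jensen's inequality for `exp` finishes. -/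
lemma exp_sum_signWeight_le {h : ι → ℝ} (hh : ∀ i, |h i| ≤ 1) (φ : (ι → Bool) → ℝ) :
    Real.exp (∑ ω, signWeight h ω * φ ω - ∑ i, h i ^ 2)
      ≤ (∑ ω, Real.exp (φ ω)) / 2 ^ Fintype.card ι := by
  have hnn : ∀ i b, 0 ≤ (1 + h i * boolSign b) / 2 := by
    intro i b
    have := abs_le.1 (hh i)
    cases b <;> simp only [boolSign] <;> norm_num <;> linarith
  have hpos : ∀ ω, 0 ≤ signWeight h ω := fun ω => Finset.prod_nonneg fun i _ => hnn i _
  have hle : ∀ ω, signWeight h ω ≤ Real.exp (∑ i, h i * boolSign (ω i)) / 2 ^ Fintype.card ι := by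
    intro ω
    rw [Real.exp_sum, ← Finset.card_univ, ← Finset.prod_const, ← Finset.prod_div_distrib]
    refine Finset.prod_le_prod (fun i _ => hnn i _) fun i _ => ?_
    have := Real.add_one_le_exp (h i * boolSign (ω i))
    linarith
  have jensen := convexOn_exp.map_sum_le (t := Finset.univ) (w := signWeight h)
    (p := fun ω => φ ω - ∑ i, h i * boolSign (ω i)) (fun ω _ => hpos ω) (sum_signWeight h)
    (fun _ _ => Set.mem_univ _)
  have e : ∑ ω, signWeight h ω • (φ ω - ∑ i, h i * boolSign (ω i))
      = ∑ ω, signWeight h ω * φ ω - ∑ i, h i ^ 2 := by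
    simp only [smul_eq_mul, mul_sub, Finset.sum_sub_distrib, Finset.mul_sum]
    congr 1
    rw [Finset.sum_comm]
    refine Finset.sum_congr rfl fun i _ => ?_
    rw [sq]
    nth_rewrite 3 [← sum_signWeight_mul_sign h i]
    rw [Finset.mul_sum]
    exact Finset.sum_congr rfl fun ω _ => by ring
  rw [e] at jensen
  refine jensen.trans ?_
  rw [Finset.sum_div]
  refine Finset.sum_le_sum fun ω _ => ?_
  rw [smul_eq_mul, Real.exp_sub, ← mul_div_assoc, div_le_iff₀ (Real.exp_pos _)]
  calc signWeight h ω * Real.exp (φ ω)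
      ≤ Real.exp (∑ i, h i * boolSign (ω i)) / 2 ^ Fintype.card ι * Real.exp (φ ω) :=
        mul_le_mul_of_nonneg_right (hle ω) (Real.exp_pos _).le
    _ = _ := by ring

lemma sum_signWeight_mul_sq (h : ι → ℝ) (v : ι → ℝ) :
    ∑ ω : ι → Bool, signWeight h ω * (∑ s, boolSign (ω s) * v s) ^ 2
      = ∑ s, ∑ t, (if s = t then 1 else h s * h t) * (v s * v t) := by
  have e : ∀ s t, ∑ ω : ι → Bool, signWeight h ω * (boolSign (ω s) * boolSign (ω t))
      = if s = t then 1 else h s * h t := by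
    intro s t
    split_ifs with hst
    · subst hst; simp only [boolSign_sq, mul_one, sum_signWeight]
    · exact sum_signWeight_mul_sign_mul_sign h hst
  simp only [← e, sq, Finset.mul_sum, Finset.sum_mul]
  rw [Finset.sum_comm]
  refine Finset.sum_congr rfl fun s _ => ?_
  rw [Finset.sum_comm]
  exact Finset.sum_congr rfl fun t _ => Finset.sum_congr rfl fun ω _ => by ring

/-- The average over signs of an exponential martingale in the direction of the signs. -/
def signAverage (κ : Finset ℕ) (μ : ℝ) (v : ι → ℕ → ℝ) : ℝ :=
  (∑ ω : ι → Bool, Real.exp (∑ a ∈ κ, μ * ∑ s, boolSign (ω s) * v s a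
    - (∑ a ∈ κ, (μ * ∑ s, boolSign (ω s) * v s a) ^ 2) / 2)) / 2 ^ Fintype.card ι

/-- If the rows of `v` are nearly orthogonal, then the sum of the squares of the row sums is
controlled by the sign average. -/
theorem exp_le_signAverage {κ : Finset ℕ} {μ L : ℝ} {v : ι → ℕ → ℝ} (hL : 0 ≤ L)
    (hv : ∀ s a, |v s a| ≤ 1) (hG : ∀ s, |∑ a ∈ κ, v s a| ≤ L)
    (hT : ∀ s t, s ≠ t → |∑ a ∈ κ, v s a * v t a| ≤ L) (hμ0 : 0 ≤ μ)
    (hμ : μ ^ 2 * (L * Fintype.card ι + L ^ 2) ≤ 1) :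
    Real.exp (μ ^ 2 * (∑ s, (∑ a ∈ κ, v s a) ^ 2) / 8
      - μ ^ 2 * (Fintype.card ι * #κ) / 2) ≤ signAverage κ μ v := by
  set G : ι → ℝ := fun s => ∑ a ∈ κ, v s a with hGdef
  set h : ι → ℝ := fun s => μ * G s / 2 with hh
  set m : ℝ := (Fintype.card ι : ℝ) with hm
  have hm0 : 0 ≤ m := Nat.cast_nonneg _
  -- The `L ^ 2` part of `hμ` makes the tilts admissible means; the `L * card` part, used in `h6`,
  -- absorbs the off-diagonal correlations. The tilt `h = μ G / 2` maximizes `μ h G - h ^ 2`.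
  have hμL : μ * L ≤ 1 := by
    have : (μ * L) ^ 2 ≤ 1 := by nlinarith [mul_nonneg (sq_nonneg μ) (mul_nonneg hL hm0)]
    exact abs_le.1 ((sq_le_one_iff_abs_le_one _).1 this) |>.2
  have hbd : ∀ s, |h s| ≤ 1 := by
    intro s
    have := mul_le_mul_of_nonneg_left (hG s) hμ0
    rw [hh]
    simp only [abs_div, abs_mul, abs_of_nonneg hμ0, Nat.abs_ofNat]
    linarith
  refine le_trans (Real.exp_le_exp.2 ?_) (exp_sum_signWeight_le hbd _)
  have e1 : ∑ ω : ι → Bool, signWeight h ω * (∑ a ∈ κ, μ * ∑ s, boolSign (ω s) * v s a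
      - (∑ a ∈ κ, (μ * ∑ s, boolSign (ω s) * v s a) ^ 2) / 2)
      = μ * (∑ s, h s * G s) - μ ^ 2 / 2 *
        (∑ s, ∑ t, (if s = t then 1 else h s * h t) * ∑ a ∈ κ, v s a * v t a) := by
    simp only [mul_sub, Finset.sum_sub_distrib]
    congr 1
    · have : ∀ ω : ι → Bool, signWeight h ω * ∑ a ∈ κ, μ * ∑ s, boolSign (ω s) * v s a
          = ∑ s, μ * G s * (signWeight h ω * boolSign (ω s)) := by
        intro ω
        simp only [hGdef, Finset.mul_sum, Finset.sum_mul]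
        rw [Finset.sum_comm]
        exact Finset.sum_congr rfl fun s _ => Finset.sum_congr rfl fun a _ => by ring
      simp only [this]
      rw [Finset.sum_comm, Finset.mul_sum]
      refine Finset.sum_congr rfl fun s _ => ?_
      rw [← Finset.mul_sum, sum_signWeight_mul_sign]
      ring
    · have : ∀ ω : ι → Bool, signWeight h ω * ((∑ a ∈ κ, (μ * ∑ s, boolSign (ω s) * v s a) ^ 2) / 2)
          = ∑ a ∈ κ, μ ^ 2 / 2 * (signWeight h ω * (∑ s, boolSign (ω s) * v s a) ^ 2) := by
        intro ω
        rw [Finset.sum_div, Finset.mul_sum]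
        exact Finset.sum_congr rfl fun a _ => by ring
      simp only [this]
      rw [Finset.sum_comm]
      simp only [← Finset.mul_sum, sum_signWeight_mul_sq]
      congr 1
      rw [Finset.sum_comm]
      refine Finset.sum_congr rfl fun s _ => ?_
      rw [Finset.sum_comm]
      exact Finset.sum_congr rfl fun t _ => by rw [Finset.mul_sum]
  rw [e1]
  have e2 : ∑ s, h s * G s = μ / 2 * ∑ s, G s ^ 2 := by
    rw [Finset.mul_sum]; exact Finset.sum_congr rfl fun s _ => by simp only [hh]; ring
  have e3 : ∑ s, h s ^ 2 = μ ^ 2 / 4 * ∑ s, G s ^ 2 := by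
    rw [Finset.mul_sum]; exact Finset.sum_congr rfl fun s _ => by simp only [hh]; ring
  have e4 : ∑ s, ∑ t, (if s = t then 1 else h s * h t) * ∑ a ∈ κ, v s a * v t a
      ≤ m * #κ + L * (m * ∑ s, h s ^ 2) := by
    have hcs : (∑ s, |h s|) ^ 2 ≤ m * ∑ s, h s ^ 2 := by
      have := sq_sum_le_card_mul_sum_sq (s := (Finset.univ : Finset ι)) (f := fun s => |h s|)
      simpa only [sq_abs, Finset.card_univ] using this
    have hterm : ∀ s t, (if s = t then 1 else h s * h t) * ∑ a ∈ κ, v s a * v t a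
        ≤ (if s = t then (#κ : ℝ) else 0) + L * (|h s| * |h t|) := by
      intro s t
      split_ifs with hst
      · subst hst
        have h1 : ∑ a ∈ κ, v s a * v s a ≤ #κ := by
          have : ∑ a ∈ κ, v s a * v s a ≤ ∑ a ∈ κ, (1 : ℝ) := by
            refine Finset.sum_le_sum fun a _ => ?_
            have := abs_le.1 (hv s a)
            nlinarith
          simpa using this
        have : 0 ≤ L * (|h s| * |h s|) := by positivity
        linarith
      · rw [zero_add]
        refine (le_abs_self _).trans ?_
        rw [abs_mul, abs_mul, mul_comm L]
        exact mul_le_mul_of_nonneg_left (hT s t hst) (by positivity)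
    calc _ ≤ ∑ s, ∑ t, ((if s = t then (#κ : ℝ) else 0) + L * (|h s| * |h t|)) :=
          Finset.sum_le_sum fun s _ => Finset.sum_le_sum fun t _ => hterm s t
      _ = m * #κ + L * (∑ s, |h s|) ^ 2 := by
          simp only [Finset.sum_add_distrib, Finset.sum_ite_eq, Finset.mem_univ, if_true,
            Finset.sum_const, Finset.card_univ, nsmul_eq_mul, ← Finset.mul_sum, sq,
            Finset.sum_mul_sum, hm]
      _ ≤ _ := by
          have := mul_le_mul_of_nonneg_left hcs hL
          linarith
  rw [e2, e3]
  rw [e3] at e4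
  set S := ∑ s, G s ^ 2
  have hS : 0 ≤ S := Finset.sum_nonneg fun s _ => sq_nonneg _
  have h5 := mul_le_mul_of_nonneg_left e4 (by positivity : 0 ≤ μ ^ 2 / 2)
  have h6 : μ ^ 2 * (L * m) ≤ 1 := by nlinarith [mul_nonneg (sq_nonneg μ) (sq_nonneg L)]
  have h7 : μ ^ 2 * (L * m) * (μ ^ 2 * S) ≤ 1 * (μ ^ 2 * S) :=
    mul_le_mul_of_nonneg_right h6 (by positivity)
  -- Coefficients of `μ ^ 2 * S`: gain `1/2`, entropy `1/4`, off-diagonal terms at most `1/8`; this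
  -- leaves `1/8`.
  nlinarith

end Gibbs

/-! ### Sums over the grid `{0, …, 2^N - 1}^3` -/

/-- The sum of a function over the grid `{0, …, 2^N - 1}^3`. -/
def gridSum (N : ℕ) (g : ℕ → ℕ → ℕ → ℝ) : ℝ :=
  ∑ i ∈ range (2 ^ N), ∑ j ∈ range (2 ^ N), ∑ k ∈ range (2 ^ N), g i j k

lemma sum_range_two_pow_le {N : ℕ} {g : ℕ → ℝ} {B : ℝ} (h : ∀ i, g i ≤ B) :
    ∑ i ∈ range (2 ^ N), g i ≤ 2 ^ N * B := by
  have := Finset.sum_le_card_nsmul (range (2 ^ N)) g B fun i _ => h i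
  simpa using this

lemma gridSum_le_of_snd {N : ℕ} {g : ℕ → ℕ → ℕ → ℝ} {B : ℝ}
    (h : ∀ i k, ∑ j ∈ range (2 ^ N), g i j k ≤ 2 ^ N * B) : gridSum N g ≤ 8 ^ N * B := by
  have : (8 : ℝ) ^ N * B = 2 ^ N * (2 ^ N * (2 ^ N * B)) := by
    rw [show (8 : ℝ) = 2 * 2 * 2 by norm_num, mul_pow, mul_pow]; ring
  rw [this]
  refine sum_range_two_pow_le fun i => ?_
  rw [Finset.sum_comm]
  exact sum_range_two_pow_le fun k => h i k

lemma gridSum_le_of_trd {N : ℕ} {g : ℕ → ℕ → ℕ → ℝ} {B : ℝ}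
    (h : ∀ i j, ∑ k ∈ range (2 ^ N), g i j k ≤ 2 ^ N * B) : gridSum N g ≤ 8 ^ N * B := by
  have : (8 : ℝ) ^ N * B = 2 ^ N * (2 ^ N * (2 ^ N * B)) := by
    rw [show (8 : ℝ) = 2 * 2 * 2 by norm_num, mul_pow, mul_pow]; ring
  rw [this]
  exact sum_range_two_pow_le fun i => sum_range_two_pow_le fun j => h i j

lemma gridSum_le_of_fst {N : ℕ} {g : ℕ → ℕ → ℕ → ℝ} {B : ℝ}
    (h : ∀ j k, ∑ i ∈ range (2 ^ N), g i j k ≤ 2 ^ N * B) : gridSum N g ≤ 8 ^ N * B := by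
  unfold gridSum
  rw [Finset.sum_comm]
  exact gridSum_le_of_snd (g := fun j i k => g i j k) fun j k => h j k

lemma gridSum_add (N : ℕ) (g h : ℕ → ℕ → ℕ → ℝ) :
    gridSum N (fun i j k => g i j k + h i j k) = gridSum N g + gridSum N h := by
  simp only [gridSum, Finset.sum_add_distrib]

lemma gridSum_mul_left (N : ℕ) (a : ℝ) (g : ℕ → ℕ → ℕ → ℝ) :
    gridSum N (fun i j k => a * g i j k) = a * gridSum N g := by
  simp only [gridSum, Finset.mul_sum]

lemma gridSum_sum {ι : Type*} (s : Finset ι) (N : ℕ) (g : ι → ℕ → ℕ → ℕ → ℝ) :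
    gridSum N (fun i j k => ∑ t ∈ s, g t i j k) = ∑ t ∈ s, gridSum N (g t) := by
  classical
  induction s using Finset.induction_on with
  | empty => simp [gridSum]
  | insert a s ha ih => simp only [Finset.sum_insert ha, gridSum_add, ih]

/-! ### Arrays with the martingale structure of hyperbolic `r`-functions -/

/-- The structure of the `r`-functions `f (s, a, n - s - a)` as functions of the first `n + 1` binary
digits of the three variables: bounded, and a martingale difference in every variable. -/
structure IsHyperbolicArray (n : ℕ) (A : ℕ → ℕ → ℕ → ℕ → ℕ → ℝ) : Prop where
  bound : ∀ s a i j k, |A s a i j k| ≤ 1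
  eq_zero : ∀ s a i j k, n < s + a → A s a i j k = 0
  fst : ∀ s a j k, IsDifference (n + 1) s (fun i => A s a i j k)
  snd : ∀ s a i k, IsDifference (n + 1) a (fun j => A s a i j k)
  trd : ∀ s a i j, IsDifference (n + 1) (n - s - a) (fun k => A s a i j k)

/-- The row sum: the sum of the array over the second index. -/
def rowSum (n : ℕ) (A : ℕ → ℕ → ℕ → ℕ → ℕ → ℝ) (s i j k : ℕ) : ℝ :=
  ∑ a ∈ range (n + 1), A s a i j k

/-- The correlation of two rows. -/
def rowCorr (n : ℕ) (A : ℕ → ℕ → ℕ → ℕ → ℕ → ℝ) (s t i j k : ℕ) : ℝ :=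
  ∑ a ∈ range (n + 1), A s a i j k * A t a i j k

lemma rowCorr_comm (n : ℕ) (A : ℕ → ℕ → ℕ → ℕ → ℕ → ℝ) (s t i j k : ℕ) :
    rowCorr n A s t i j k = rowCorr n A t s i j k :=
  Finset.sum_congr rfl fun _ _ => mul_comm _ _

/-- Reindexes a row by its third coordinate `b = n - s - a`, so that correlations become sums over
the digits of the third variable. -/
lemma sum_range_eq_sum_sub {n s : ℕ} {g : ℕ → ℝ} (hg : ∀ a, n < s + a → g a = 0) :
    ∑ a ∈ range (n + 1), g a
      = ∑ b ∈ range (n + 1), if s + b ≤ n then g (n - s - b) else 0 := by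
  have h1 : ∑ a ∈ range (n + 1), g a = ∑ a ∈ range (n + 1), if s + a ≤ n then g a else 0 :=
    Finset.sum_congr rfl fun a _ => by
      split_ifs with h
      · rfl
      · exact hg a (by omega)
  rw [h1, ← Finset.sum_filter, ← Finset.sum_filter]
  refine Finset.sum_nbij' (fun a => n - s - a) (fun a => n - s - a) ?_ ?_ ?_ ?_ ?_
  · intro a ha; simp only [Finset.mem_filter, Finset.mem_range] at ha ⊢; omega
  · intro a ha; simp only [Finset.mem_filter, Finset.mem_range] at ha ⊢; omega
  · intro a ha; simp only [Finset.mem_filter, Finset.mem_range] at ha ⊢; omega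
  · intro a ha; simp only [Finset.mem_filter, Finset.mem_range] at ha ⊢; omega
  · intro a ha
    simp only [Finset.mem_filter, Finset.mem_range] at ha
    rw [show n - s - (n - s - a) = a by omega]

namespace IsHyperbolicArray

variable {n : ℕ} {A : ℕ → ℕ → ℕ → ℕ → ℕ → ℝ}

lemma gridSum_tailWeight_rowSum_le (hA : IsHyperbolicArray n A) (L : ℝ) (s : ℕ) :
    gridSum (n + 1) (fun i j k => tailWeight (n + 1) L (rowSum n A s i j k))
      ≤ 8 ^ (n + 1) * (2 * Real.exp (-(L ^ 2 / (2 * (n + 1 : ℕ))))) :=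
  gridSum_le_of_snd fun i k =>
    sum_tailWeight_le n.succ_pos (D := fun a j => A s a i j k) (fun a _ => hA.snd s a i k)
      (fun a j => hA.bound s a i j k) L

/-- At a common second index the third index of row `t` is smaller than that of row `s`. With the
first two variables fixed, the product is thus a martingale difference at the digit `b` of row `s`.
-/
lemma gridSum_tailWeight_rowCorr_le_of_lt (hA : IsHyperbolicArray n A) (L : ℝ) {s t : ℕ}
    (hst : s < t) :
    gridSum (n + 1) (fun i j k => tailWeight (n + 1) L (rowCorr n A s t i j k))
      ≤ 8 ^ (n + 1) * (2 * Real.exp (-(L ^ 2 / (2 * (n + 1 : ℕ))))) := by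
  refine gridSum_le_of_trd fun i j => ?_
  have key : ∀ k, rowCorr n A s t i j k = ∑ b ∈ range (n + 1),
      if s + b ≤ n then A s (n - s - b) i j k * A t (n - s - b) i j k else 0 := fun k =>
    sum_range_eq_sum_sub (g := fun a => A s a i j k * A t a i j k) fun a ha => by
      simp only [hA.eq_zero s a i j k ha, zero_mul]
  simp only [key]
  refine sum_tailWeight_le n.succ_pos (D := fun b k =>
    if s + b ≤ n then A s (n - s - b) i j k * A t (n - s - b) i j k else 0) ?_ ?_ L
  · intro b hb
    by_cases h : s + b ≤ n
    · simp only [h, if_true]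
      by_cases h' : t + (n - s - b) ≤ n
      · have h1 := hA.trd s (n - s - b) i j
        rw [show n - s - (n - s - b) = b by omega] at h1
        exact h1.mul_earlier (hA.trd t (n - s - b) i j) (by omega) (by omega)
      · simp only [hA.eq_zero t (n - s - b) _ _ _ (not_le.1 h'), mul_zero]
        exact IsDifference.zero _ _
    · simp only [h, if_false]
      exact IsDifference.zero _ _
  · intro b k
    split_ifs
    · rw [abs_mul]
      exact mul_le_one₀ (hA.bound _ _ _ _ _) (abs_nonneg _) (hA.bound _ _ _ _ _)
    · simp

lemma gridSum_tailWeight_rowCorr_le (hA : IsHyperbolicArray n A) (L : ℝ) {s t : ℕ}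
    (hst : s ≠ t) :
    gridSum (n + 1) (fun i j k => tailWeight (n + 1) L (rowCorr n A s t i j k))
      ≤ 8 ^ (n + 1) * (2 * Real.exp (-(L ^ 2 / (2 * (n + 1 : ℕ))))) := by
  rcases lt_or_gt_of_ne hst with h | h
  · exact hA.gridSum_tailWeight_rowCorr_le_of_lt L h
  · simp only [rowCorr_comm n A s t]
    exact hA.gridSum_tailWeight_rowCorr_le_of_lt L h

/-- For fixed signs and fixed outer variables, the signed column sums are martingale differences in
the second variable; the supermartingale bound survives averaging over the signs. -/
lemma gridSum_signAverage_le (hA : IsHyperbolicArray n A) (J : Finset ℕ) (μ : ℝ) :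
    gridSum (n + 1) (fun i j k => signAverage (range (n + 1)) μ (fun (s : J) a => A s a i j k))
      ≤ 8 ^ (n + 1) * 1 := by
  refine gridSum_le_of_snd fun i k => ?_
  simp only [signAverage]
  rw [← Finset.sum_div, Finset.sum_comm, div_le_iff₀ (by positivity)]
  have h : ∀ ω : J → Bool, ∑ j ∈ range (2 ^ (n + 1)),
      Real.exp (∑ a ∈ range (n + 1), μ * ∑ s : J, boolSign (ω s) * A s a i j k
      - (∑ a ∈ range (n + 1), (μ * ∑ s : J, boolSign (ω s) * A s a i j k) ^ 2) / 2)
      ≤ 2 ^ (n + 1) := fun ω =>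
    sum_exp_sub_sq_le (D := fun a j => μ * ∑ s : J, boolSign (ω s) * A s a i j k) fun a _ =>
      (IsDifference.sum Finset.univ (g := fun (s : J) j => boolSign (ω s) * A s a i j k)
        fun s _ => (hA.snd s a i k).const_mul _).const_mul μ
  calc _ ≤ ∑ ω : J → Bool, (2 : ℝ) ^ (n + 1) := Finset.sum_le_sum fun ω _ => h ω
    _ = _ := by
      simp only [Finset.sum_const, Finset.card_univ, Fintype.card_fun, Fintype.card_bool,
        nsmul_eq_mul]
      push_cast
      ring

lemma gridSum_exp_sum_rowSum_le (hA : IsHyperbolicArray n A) {J : Finset ℕ}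
    (hJ : J ⊆ range (n + 1)) (lam : ℝ) :
    gridSum (n + 1) (fun i j k => Real.exp (lam * ∑ s ∈ J, rowSum n A s i j k
      - lam ^ 2 * (∑ s ∈ J, rowSum n A s i j k ^ 2) / 2)) ≤ 8 ^ (n + 1) * 1 := by
  refine gridSum_le_of_fst fun j k => ?_
  rw [mul_one]
  refine le_trans (le_of_eq ?_) (sum_exp_sub_sq_le
    (D := fun s i => if s ∈ J then lam * rowSum n A s i j k else 0) ?_)
  · refine Finset.sum_congr rfl fun i _ => ?_
    have e1 : ∑ s ∈ range (n + 1), (if s ∈ J then lam * rowSum n A s i j k else 0)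
        = lam * ∑ s ∈ J, rowSum n A s i j k := by
      rw [Finset.sum_ite_mem, Finset.inter_eq_right.2 hJ, Finset.mul_sum]
    have e2 : ∑ s ∈ range (n + 1), (if s ∈ J then lam * rowSum n A s i j k else 0) ^ 2
        = lam ^ 2 * ∑ s ∈ J, rowSum n A s i j k ^ 2 := by
      simp only [ite_pow, zero_pow (two_ne_zero : (2 : ℕ) ≠ 0)]
      rw [Finset.sum_ite_mem, Finset.inter_eq_right.2 hJ, Finset.mul_sum]
      exact Finset.sum_congr rfl fun s _ => by ring
    rw [e1, e2]
  · intro s _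
    by_cases h : s ∈ J
    · simp only [h, if_true]
      exact (IsDifference.sum _ fun a _ => hA.fst s a j k).const_mul lam
    · simp only [h, if_false]
      exact IsDifference.zero _ _

/-- The tail bound for the sum of the array over `s ∈ J`, in the form of a majorant of the
indicator function of the exceptional set. -/
theorem exists_majorant (hA : IsHyperbolicArray n A) {J : Finset ℕ}
    (hJ : J ⊆ range (n + 1)) {L u V : ℝ} (hL : 0 < L) (hu : 0 < u)
    (hV : 4 * (#J * (n + 1 : ℕ)) + 8 * u * (L * #J + L ^ 2) ≤ V) :
    ∃ B : ℕ → ℕ → ℕ → ℝ, (∀ i j k, 0 ≤ B i j k) ∧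
      (∀ i j k, √(2 * u * V) < |∑ s ∈ J, rowSum n A s i j k| → 1 ≤ B i j k) ∧
      gridSum (n + 1) B ≤ 8 ^ (n + 1) * (3 * Real.exp (-u)
        + (2 * #J + 2 * #J ^ 2) * Real.exp (-(L ^ 2 / (2 * (n + 1 : ℕ))))) := by
  set m : ℝ := (#J : ℝ) with hm
  have hm0 : 0 ≤ m := Nat.cast_nonneg _
  -- Here `q` is not the number of blocks. The choice `μ ^ 2 = 1 / q` is the largest that
  -- `exp_le_signAverage` allows.
  set q : ℝ := L * m + L ^ 2 with hq
  have hq0 : 0 < q := by positivity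
  have hV0 : 0 < V := lt_of_lt_of_le (by positivity) hV
  set μ : ℝ := √(1 / q) with hμ
  have hμ2 : μ ^ 2 = 1 / q := Real.sq_sqrt (by positivity)
  -- Chernoff at the level `√(2uV)`: the linear term is then at least `2 * u`, and the quadratic one
  -- at most `u` where `S ≤ V`.
  set lam : ℝ := √(2 * u / V) with hlam
  have hlam2 : lam ^ 2 = 2 * u / V := Real.sq_sqrt (by positivity)
  have hlam0 : 0 ≤ lam := Real.sqrt_nonneg _
  have hly : lam * √(2 * u * V) = 2 * u := by
    rw [hlam, ← Real.sqrt_mul (by positivity), show 2 * u / V * (2 * u * V) = (2 * u) ^ 2 by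
      field_simp, Real.sqrt_sq (by positivity)]
  set E : ℝ → ℕ → ℕ → ℕ → ℝ := fun l i j k => Real.exp (l * ∑ s ∈ J, rowSum n A s i j k
      - l ^ 2 * (∑ s ∈ J, rowSum n A s i j k ^ 2) / 2) with hE
  set Z : ℕ → ℕ → ℕ → ℝ := fun i j k =>
    signAverage (range (n + 1)) μ (fun (s : J) a => A s a i j k) with hZ
  set P : ℕ → ℕ → ℕ → ℝ := fun i j k => ∑ s ∈ J, tailWeight (n + 1) L (rowSum n A s i j k) with hP
  set R : ℕ → ℕ → ℕ → ℝ := fun i j k => ∑ st ∈ J.offDiag,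
    tailWeight (n + 1) L (rowCorr n A st.1 st.2 i j k) with hR
  have hE0 : ∀ l i j k, 0 ≤ E l i j k := fun l i j k => (Real.exp_pos _).le
  have hZ0 : ∀ i j k, 0 ≤ Z i j k := fun i j k => by
    simp only [hZ, signAverage]; positivity
  have hP0 : ∀ i j k, 0 ≤ P i j k := fun i j k =>
    Finset.sum_nonneg fun _ _ => tailWeight_nonneg _ _ _
  have hR0 : ∀ i j k, 0 ≤ R i j k := fun i j k =>
    Finset.sum_nonneg fun _ _ => tailWeight_nonneg _ _ _
  have hexp := Real.exp_pos (-u)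
  -- One summand per way to fail: `P` for a large row sum, `R` for a large correlation, `Z` for `S >
  -- V`, and the two `E` for a large sum of either sign while `S ≤ V`.
  refine ⟨fun i j k => Real.exp (-u) * ((E lam i j k + E (-lam) i j k) + Z i j k)
    + (P i j k + R i j k), fun i j k => ?_, fun i j k hF => ?_, ?_⟩
  · have := hE0 lam i j k; have := hE0 (-lam) i j k; have := hZ0 i j k
    have := hP0 i j k; have := hR0 i j k
    positivity
  · have g1 := hE0 lam i j k; have g2 := hE0 (-lam) i j k; have g3 := hZ0 i j k
    have g4 := hP0 i j k; have g5 := hR0 i j k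
    have g6 : 0 ≤ Real.exp (-u) * ((E lam i j k + E (-lam) i j k) + Z i j k) := by positivity
    by_cases hG : ∃ s ∈ J, L < |rowSum n A s i j k|
    · obtain ⟨s, hs, h⟩ := hG
      have h1 := one_le_tailWeight (N := n + 1) hL.le h
      have h2 : _ ≤ P i j k := Finset.single_le_sum
        (f := fun s => tailWeight (n + 1) L (rowSum n A s i j k))
        (fun _ _ => tailWeight_nonneg _ _ _) hs
      linarith
    by_cases hT : ∃ st ∈ J.offDiag, L < |rowCorr n A st.1 st.2 i j k|
    · obtain ⟨s, hs, h⟩ := hT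
      have h1 := one_le_tailWeight (N := n + 1) hL.le h
      have h2 : _ ≤ R i j k := Finset.single_le_sum
        (f := fun st : ℕ × ℕ => tailWeight (n + 1) L (rowCorr n A st.1 st.2 i j k))
        (fun _ _ => tailWeight_nonneg _ _ _) hs
      linarith
    push Not at hG hT
    have one_le : ∀ x, Real.exp u ≤ x → 1 ≤ Real.exp (-u) * x := by
      intro x hx
      have := mul_le_mul_of_nonneg_left hx hexp.le
      rwa [← Real.exp_add, neg_add_cancel, Real.exp_zero] at this
    set S := ∑ s ∈ J, rowSum n A s i j k ^ 2 with hS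
    have main : Real.exp u ≤ (E lam i j k + E (-lam) i j k) + Z i j k := by
      by_cases hSV : V < S
      · have h := exp_le_signAverage (κ := range (n + 1)) (μ := μ) (L := L)
          (v := fun (s : J) a => A s a i j k) hL.le (fun s a => hA.bound _ _ _ _ _)
          (fun s => hG s s.2)
          (fun s t hst => hT (s, t) (by simp [Finset.mem_offDiag, Subtype.coe_injective.ne hst]))
          (Real.sqrt_nonneg _) (by
            rw [hμ2, Fintype.card_coe, ← hm, ← hq]; exact (one_div_mul_cancel hq0.ne').le)
        rw [Finset.sum_coe_sort J (fun s => (∑ a ∈ range (n + 1), A s a i j k) ^ 2),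
          Fintype.card_coe, Finset.card_range, hμ2] at h
        refine le_trans (Real.exp_le_exp.2 ?_) (h.trans (by linarith))
        have h1 : 4 * (m * (n + 1 : ℕ)) + 8 * u * q ≤ S := hV.trans hSV.le
        have h2 := mul_le_mul_of_nonneg_left h1 (by positivity : 0 ≤ 1 / q / 8)
        have h3 : 1 / q / 8 * (4 * (m * (n + 1 : ℕ)) + 8 * u * q)
            = u + 1 / q * (m * (n + 1 : ℕ)) / 2 := by field_simp; ring
        rw [h3] at h2
        have h4 : 1 / q / 8 * S = 1 / q * S / 8 := by ring
        rw [h4] at h2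
        have h5 : S = ∑ s ∈ J, (∑ a ∈ range (n + 1), A s a i j k) ^ 2 := rfl
        rw [← h5]
        linarith
      · have h1 : lam ^ 2 * S / 2 ≤ u := by
          have := mul_le_mul_of_nonneg_left (not_lt.1 hSV) (sq_nonneg lam)
          have h2 : lam ^ 2 * V = 2 * u := by rw [hlam2]; field_simp
          linarith
        have h2 : 2 * u ≤ lam * |∑ s ∈ J, rowSum n A s i j k| := by
          rw [← hly]; exact mul_le_mul_of_nonneg_left hF.le hlam0
        rcases abs_choice (∑ s ∈ J, rowSum n A s i j k) with h | h
        · have : Real.exp u ≤ E lam i j k := by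
            refine Real.exp_le_exp.2 ?_
            rw [h] at h2; rw [← hS]; linarith
          linarith
        · have : Real.exp u ≤ E (-lam) i j k := by
            refine Real.exp_le_exp.2 ?_
            rw [h] at h2; rw [← hS, neg_sq]; linarith
          linarith
    have := one_le _ main
    linarith
  · rw [gridSum_add, gridSum_mul_left, gridSum_add, gridSum_add, gridSum_add, gridSum_sum,
      gridSum_sum]
    have h1 := hA.gridSum_exp_sum_rowSum_le hJ lam
    have h2 := hA.gridSum_exp_sum_rowSum_le hJ (-lam)
    have h3 := hA.gridSum_signAverage_le J μ
    set X := Real.exp (-(L ^ 2 / (2 * (n + 1 : ℕ)))) with hX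
    have hX0 : 0 < X := Real.exp_pos _
    have h4 := Finset.sum_le_card_nsmul J _ _ fun s _ => hA.gridSum_tailWeight_rowSum_le L s
    have h5 := Finset.sum_le_card_nsmul J.offDiag
      (fun st => gridSum (n + 1) fun i j k => tailWeight (n + 1) L (rowCorr n A st.1 st.2 i j k))
      _ fun st hst => hA.gridSum_tailWeight_rowCorr_le L (Finset.mem_offDiag.1 hst).2.2
    rw [nsmul_eq_mul, ← hX] at h4 h5
    have h6 : ((#J.offDiag : ℕ) : ℝ) ≤ m ^ 2 := by
      rw [Finset.offDiag_card, hm, sq]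
      exact_mod_cast Nat.sub_le _ _
    have h7 : ((#J.offDiag : ℕ) : ℝ) * (8 ^ (n + 1) * (2 * X)) ≤ m ^ 2 * (8 ^ (n + 1) * (2 * X)) :=
      mul_le_mul_of_nonneg_right h6 (by positivity)
    have h8 := mul_le_mul_of_nonneg_left (add_le_add (add_le_add h1 h2) h3) hexp.le
    refine le_trans (add_le_add h8 (add_le_add h4 (h5.trans h7))) (le_of_eq ?_)
    ring

end IsHyperbolicArray

/-! ### Binary digits of the variables -/

lemma mem_dyadicInterval_iff {k m : ℕ} {x : ℝ} (hx : 0 ≤ x) :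
    x ∈ dyadicInterval k m ↔ ⌊2 ^ k * x⌋₊ = m := by
  have h2 : (0 : ℝ) < 2 ^ k := by positivity
  rw [Nat.floor_eq_iff (by positivity), dyadicInterval, Set.mem_Ico, div_le_iff₀ h2,
    lt_div_iff₀ h2, mul_comm x]

lemma floor_two_pow_mul {k N : ℕ} (h : k ≤ N) (x : ℝ) :
    ⌊2 ^ k * x⌋₊ = ⌊2 ^ N * x⌋₊ / 2 ^ (N - k) := by
  have : (2 : ℝ) ^ k * x = 2 ^ N * x / ((2 ^ (N - k) : ℕ) : ℝ) := by
    rw [eq_div_iff (by positivity)]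
    push_cast
    rw [mul_right_comm, ← pow_add, Nat.add_sub_cancel' h]
  rw [this, Nat.floor_div_natCast]

lemma haar_eq {k m : ℕ} {x : ℝ} (hx : 0 ≤ x) :
    haar k m x = if ⌊2 ^ k * x⌋₊ = m then digitSign ⌊2 ^ (k + 1) * x⌋₊ else 0 := by
  have h := floor_two_pow_mul (Nat.le_succ k) x
  rw [show k.succ - k = 1 by omega, pow_one] at h
  simp only [haar, Set.indicator, mem_dyadicInterval_iff hx, Pi.one_apply, digitSign]
  rw [h]
  generalize ⌊2 ^ (k + 1) * x⌋₊ = t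
  split_ifs <;> first | omega | norm_num

/-- An `r`-function is the product of the signs of the digits `r i` and of a coefficient that depends
on the earlier digits. -/
lemma IsRFunction.exists_coeff {r : Fin 3 → ℕ} {f : (Fin 3 → ℝ) → ℝ} (hf : IsRFunction r f) :
    ∃ e : (Fin 3 → ℕ) → ℝ, (∀ m, |e m| ≤ 1) ∧ ∀ x : Fin 3 → ℝ, (∀ i, 0 ≤ x i ∧ x i < 1) →
      f x = e (fun i => ⌊2 ^ r i * x i⌋₊) * ∏ i, digitSign ⌊2 ^ (r i + 1) * x i⌋₊ := by
  classical
  obtain ⟨ε, hε, hf⟩ := hf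
  -- The default `0` is never met on `[0,1)^3`; it only makes the coefficient total and bounded.
  refine ⟨fun m => if h : ∀ i, m i < 2 ^ r i then ε (fun i => ⟨m i, h i⟩) else 0, ?_, ?_⟩
  · intro m
    dsimp only
    split_ifs with h
    · rcases hε (fun i => ⟨m i, h i⟩) with h | h <;> rw [h] <;> simp
    · simp
  · intro x hx
    have hlt : ∀ i, ⌊2 ^ r i * x i⌋₊ < 2 ^ r i := by
      intro i
      rw [Nat.floor_lt (mul_nonneg (by positivity) (hx i).1)]
      push_cast
      have : (0 : ℝ) < 2 ^ r i := by positivity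
      nlinarith [(hx i).2]
    dsimp only
    rw [hf, dif_pos hlt, Finset.sum_eq_single (fun i => ⟨⌊2 ^ r i * x i⌋₊, hlt i⟩)]
    · congr 1
      refine Finset.prod_congr rfl fun i _ => ?_
      rw [haar_eq (hx i).1, if_pos rfl]
    · intro R _ hR
      obtain ⟨i, hi⟩ := Function.ne_iff.1 hR
      have : haarRect r R x = 0 := by
        refine Finset.prod_eq_zero (Finset.mem_univ i) ?_
        rw [haar_eq (hx i).1, if_neg]
        intro h
        exact hi (Fin.ext h.symm)
      rw [this, mul_zero]
    · simp

lemma mem_hyperbolicVectors {n : ℕ} {r : Fin 3 → ℕ} :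
    r ∈ hyperbolicVectors n ↔ r 0 + r 1 + r 2 = n := by
  rw [hyperbolicVectors, Finset.Nat.mem_antidiagonalTuple, Fin.sum_univ_three]

/-- The hyperbolic vector with given first and second coordinates. -/
def hyperbolicVector (n s a : ℕ) : Fin 3 → ℕ := ![s, a, n - s - a]

lemma blockSum_eq (n : ℕ) {J : Finset ℕ} (f : (Fin 3 → ℕ) → (Fin 3 → ℝ) → ℝ) (x : Fin 3 → ℝ) :
    blockSum n J f x = ∑ s ∈ J, ∑ a ∈ range (n + 1),
      if s + a ≤ n then f (hyperbolicVector n s a) x else 0 := by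
  rw [← Finset.sum_product', ← Finset.sum_filter, blockSum]
  refine Finset.sum_nbij' (fun r => (r 0, r 1)) (fun p => hyperbolicVector n p.1 p.2) ?_ ?_ ?_ ?_ ?_
  · intro r hr
    simp only [Finset.mem_filter, mem_hyperbolicVectors, Finset.mem_product, Finset.mem_range]
      at hr ⊢
    exact ⟨⟨hr.2, by omega⟩, by omega⟩
  · intro p hp
    simp only [Finset.mem_filter, mem_hyperbolicVectors, Finset.mem_product, Finset.mem_range,
      hyperbolicVector, Matrix.cons_val] at hp ⊢
    exact ⟨by omega, hp.1.1⟩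
  · intro r hr
    simp only [Finset.mem_filter, mem_hyperbolicVectors] at hr
    ext i
    fin_cases i <;> simp [hyperbolicVector]
    omega
  · intro p _
    simp [hyperbolicVector]
  · intro r hr
    simp only [Finset.mem_filter, mem_hyperbolicVectors] at hr
    congr 1
    ext i
    fin_cases i <;> simp [hyperbolicVector]
    omega

/-- The block sums of `r`-functions are, in terms of the first `n + 1` digits of the variables, the
block sums of an array with the martingale structure. -/
theorem exists_isHyperbolicArray {n : ℕ} {f : (Fin 3 → ℕ) → (Fin 3 → ℝ) → ℝ}
    (hf : ∀ r ∈ hyperbolicVectors n, IsRFunction r (f r)) :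
    ∃ A, IsHyperbolicArray n A ∧ ∀ (J : Finset ℕ) (x : Fin 3 → ℝ), (∀ i, 0 ≤ x i ∧ x i < 1) →
      blockSum n J f x = ∑ s ∈ J, rowSum n A s ⌊2 ^ (n + 1) * x 0⌋₊ ⌊2 ^ (n + 1) * x 1⌋₊
        ⌊2 ^ (n + 1) * x 2⌋₊ := by
  have hf' : ∀ s a, s + a ≤ n → IsRFunction (hyperbolicVector n s a) (f (hyperbolicVector n s a)) :=
    fun s a h => hf _ (mem_hyperbolicVectors.2 (by
      simp only [hyperbolicVector, Matrix.cons_val]; omega))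
  choose! e he1 he2 using fun s a h => (hf' s a h).exists_coeff
  -- All indices are at most `n`, so `n + 1` digits suffice. The guard discards the pairs where `n -
  -- s - a` is truncated.
  let A : ℕ → ℕ → ℕ → ℕ → ℕ → ℝ := fun s a i j k => if s + a ≤ n then
    e s a ![i / 2 ^ (n + 1 - s), j / 2 ^ (n + 1 - a), k / 2 ^ (n + 1 - (n - s - a))] *
      (digitSign (i / 2 ^ (n + 1 - 1 - s)) * digitSign (j / 2 ^ (n + 1 - 1 - a)) *
        digitSign (k / 2 ^ (n + 1 - 1 - (n - s - a)))) else 0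
  have hA0 : ∀ s a i j k, ¬ s + a ≤ n → A s a i j k = 0 := fun s a i j k h => if_neg h
  have hA1 : ∀ s a i j k, s + a ≤ n → A s a i j k =
    e s a ![i / 2 ^ (n + 1 - s), j / 2 ^ (n + 1 - a), k / 2 ^ (n + 1 - (n - s - a))] *
      (digitSign (i / 2 ^ (n + 1 - 1 - s)) * digitSign (j / 2 ^ (n + 1 - 1 - a)) *
        digitSign (k / 2 ^ (n + 1 - 1 - (n - s - a)))) := fun s a i j k h => if_pos h
  refine ⟨A, ⟨?_, fun s a i j k h => hA0 _ _ _ _ _ (by omega), ?_, ?_, ?_⟩, ?_⟩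
  · intro s a i j k
    by_cases h : s + a ≤ n
    · rw [hA1 _ _ _ _ _ h]
      simp only [abs_mul, abs_digitSign, mul_one]
      exact he1 s a h _
    · rw [hA0 _ _ _ _ _ h]; simp
  · intro s a j k
    by_cases h : s + a ≤ n
    · refine ⟨fun i => e s a ![i, j / 2 ^ (n + 1 - a), k / 2 ^ (n + 1 - (n - s - a))] *
        (digitSign (j / 2 ^ (n + 1 - 1 - a)) * digitSign (k / 2 ^ (n + 1 - 1 - (n - s - a)))),
        fun i => ?_⟩
      simp only [hA1 _ _ _ _ _ h]; ring
    · simp only [hA0 _ _ _ _ _ h]; exact IsDifference.zero _ _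
  · intro s a i k
    by_cases h : s + a ≤ n
    · refine ⟨fun j => e s a ![i / 2 ^ (n + 1 - s), j, k / 2 ^ (n + 1 - (n - s - a))] *
        (digitSign (i / 2 ^ (n + 1 - 1 - s)) * digitSign (k / 2 ^ (n + 1 - 1 - (n - s - a)))),
        fun j => ?_⟩
      simp only [hA1 _ _ _ _ _ h]; ring
    · simp only [hA0 _ _ _ _ _ h]; exact IsDifference.zero _ _
  · intro s a i j
    by_cases h : s + a ≤ n
    · refine ⟨fun k => e s a ![i / 2 ^ (n + 1 - s), j / 2 ^ (n + 1 - a), k] *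
        (digitSign (i / 2 ^ (n + 1 - 1 - s)) * digitSign (j / 2 ^ (n + 1 - 1 - a))),
        fun k => ?_⟩
      simp only [hA1 _ _ _ _ _ h]; ring
    · simp only [hA0 _ _ _ _ _ h]; exact IsDifference.zero _ _
  · intro J x hx
    rw [blockSum_eq]
    refine Finset.sum_congr rfl fun s _ => Finset.sum_congr rfl fun a _ => ?_
    split_ifs with h
    · rw [he2 s a h x hx, hA1 _ _ _ _ _ h, Fin.prod_univ_three]
      have h1 : ∀ b, b ≤ n → ∀ y : ℝ, ⌊2 ^ b * y⌋₊ = ⌊2 ^ (n + 1) * y⌋₊ / 2 ^ (n + 1 - b) :=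
        fun b hb y => floor_two_pow_mul (by omega) y
      have h2 : ∀ b, b ≤ n → ∀ y : ℝ,
          ⌊2 ^ (b + 1) * y⌋₊ = ⌊2 ^ (n + 1) * y⌋₊ / 2 ^ (n + 1 - 1 - b) := fun b hb y => by
        rw [floor_two_pow_mul (by omega : b + 1 ≤ n + 1) y,
          show n + 1 - (b + 1) = n + 1 - 1 - b by omega]
      congr 1
      · congr 1
        ext i
        fin_cases i
        · exact h1 s (by omega) _
        · exact h1 a (by omega) _
        · exact h1 (n - s - a) (by omega) _
      · congr 1
        · congr 1
          · exact congrArg _ (h2 s (by omega) _)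
          · exact congrArg _ (h2 a (by omega) _)
        · exact congrArg _ (h2 (n - s - a) (by omega) _)
    · rw [hA0 _ _ _ _ _ h]

/-- The measure of a set whose indicator function is bounded, in terms of the first `N` digits, by a
function with known grid sum. -/
theorem cubeMeasure_le {N : ℕ} {B : ℕ → ℕ → ℕ → ℝ} {δ : ℝ} (hB : ∀ i j k, 0 ≤ B i j k)
    (hsum : gridSum N B ≤ 8 ^ N * δ) {S : Set (Fin 3 → ℝ)}
    (hS : ∀ x : Fin 3 → ℝ, (∀ i, 0 ≤ x i ∧ x i < 1) → x ∈ S →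
      1 ≤ B ⌊2 ^ N * x 0⌋₊ ⌊2 ^ N * x 1⌋₊ ⌊2 ^ N * x 2⌋₊) :
    cubeMeasure S ≤ ENNReal.ofReal δ := by
  classical
  -- The faces where some coordinate equals `1` are null; the half-open cube is tiled exactly by `8
  -- ^ N` dyadic cells.
  have e : cubeMeasure = volume.restrict (Set.pi Set.univ fun _ : Fin 3 => Set.Ico (0 : ℝ) 1) :=
    Measure.restrict_congr_set Measure.univ_pi_Ico_ae_eq_Icc.symm
  rw [e, Measure.restrict_apply' (MeasurableSet.univ_pi fun _ => measurableSet_Ico)]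
  let box : ℕ × ℕ × ℕ → Set (Fin 3 → ℝ) := fun p => Set.pi Set.univ
    ![dyadicInterval N p.1, dyadicInterval N p.2.1, dyadicInterval N p.2.2]
  set Q := ((range (2 ^ N)) ×ˢ ((range (2 ^ N)) ×ˢ (range (2 ^ N)))) with hQ
  have hint : ∀ m, volume (dyadicInterval N m) = ENNReal.ofReal (1 / 2 ^ N) := by
    intro m
    rw [dyadicInterval, Real.volume_Ico]
    congr 1
    ring
  have hbox : ∀ p, volume (box p) = ENNReal.ofReal (1 / 8 ^ N) := by
    intro p
    rw [volume_pi, Measure.pi_pi, Fin.prod_univ_three]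
    simp only [Matrix.cons_val, hint]
    rw [← ENNReal.ofReal_mul (by positivity), ← ENNReal.ofReal_mul (by positivity)]
    congr 1
    rw [show (8 : ℝ) = 2 * 2 * 2 by norm_num, mul_pow, mul_pow]
    field_simp
  have hsub : S ∩ (Set.pi Set.univ fun _ : Fin 3 => Set.Ico (0 : ℝ) 1)
      ⊆ ⋃ p ∈ Q.filter (fun p => 1 ≤ B p.1 p.2.1 p.2.2), box p := by
    rintro x ⟨hxS, hx⟩
    have hx' : ∀ i, 0 ≤ x i ∧ x i < 1 := fun i => hx i (Set.mem_univ i)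
    have hlt : ∀ i, ⌊2 ^ N * x i⌋₊ < 2 ^ N := by
      intro i
      rw [Nat.floor_lt (mul_nonneg (by positivity) (hx' i).1)]
      push_cast
      have : (0 : ℝ) < 2 ^ N := by positivity
      nlinarith [(hx' i).2]
    simp only [Set.mem_iUnion]
    refine ⟨(⌊2 ^ N * x 0⌋₊, ⌊2 ^ N * x 1⌋₊, ⌊2 ^ N * x 2⌋₊), ?_, ?_⟩
    · simp only [hQ, Finset.mem_filter, Finset.mem_product, Finset.mem_range]
      exact ⟨⟨hlt 0, hlt 1, hlt 2⟩, hS x hx' hxS⟩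
    · intro i _
      fin_cases i <;> exact (mem_dyadicInterval_iff (hx' _).1).2 rfl
  refine (measure_mono hsub).trans ((measure_biUnion_finset_le _ _).trans ?_)
  simp only [hbox, Finset.sum_const, nsmul_eq_mul]
  rw [← ENNReal.ofReal_natCast, ← ENNReal.ofReal_mul (Nat.cast_nonneg _)]
  refine ENNReal.ofReal_le_ofReal ?_
  rw [mul_one_div, div_le_iff₀ (by positivity), mul_comm δ]
  refine le_trans ?_ hsum
  have h1 : gridSum N B = ∑ p ∈ Q, B p.1 p.2.1 p.2.2 := by
    rw [hQ, Finset.sum_product, gridSum]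
    exact Finset.sum_congr rfl fun i _ => by rw [Finset.sum_product]
  rw [h1]
  calc ((#(Q.filter fun p => 1 ≤ B p.1 p.2.1 p.2.2) : ℕ) : ℝ)
      = ∑ p ∈ Q.filter (fun p => 1 ≤ B p.1 p.2.1 p.2.2), (1 : ℝ) := by simp
    _ ≤ ∑ p ∈ Q.filter (fun p => 1 ≤ B p.1 p.2.1 p.2.2), B p.1 p.2.1 p.2.2 :=
        Finset.sum_le_sum fun p hp => (Finset.mem_filter.1 hp).2
    _ ≤ _ := Finset.sum_le_sum_of_subset_of_nonneg (Finset.filter_subset _ _)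
        fun p _ _ => hB _ _ _

/-! ### The tail bound at all levels -/

lemma IsIntervalPartition.subset_range {n q : ℕ} {I : Fin q → Finset ℕ}
    (hI : IsIntervalPartition n q I) (t : Fin q) : I t ⊆ range (n + 1) := by
  intro s hs
  have : s ∈ Finset.univ.biUnion I := Finset.mem_biUnion.2 ⟨t, Finset.mem_univ t, hs⟩
  rw [hI.cover, Finset.mem_Icc] at this
  exact Finset.mem_range.2 (by omega)

lemma IsIntervalPartition.card_mul_le {n q : ℕ} {I : Fin q → Finset ℕ}
    (hI : IsIntervalPartition n q I) (hqn : q ≤ n) (t : Fin q) : #(I t) * q ≤ 2 * n := by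
  have h1 : #(I t) ≤ n / q + 1 := by rcases hI.length t with h | h <;> omega
  have h2 := Nat.div_mul_le_self n q
  calc #(I t) * q ≤ (n / q + 1) * q := Nat.mul_le_mul_right _ h1
    _ = n / q * q + q := by ring
    _ ≤ 2 * n := by omega

/-- The tail bound for a block sum, uniformly over `1 ≤ p ≤ n ^ (1 / 3)` and levels `w ≥ 1`. -/
theorem cubeMeasure_lt_abs_blockSum_le {n q : ℕ} (hqn : q ^ 3 ≤ n) {I : Fin q → Finset ℕ}
    (hI : IsIntervalPartition n q I) {f : (Fin 3 → ℕ) → (Fin 3 → ℝ) → ℝ}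
    (hf : ∀ r ∈ hyperbolicVectors n, IsRFunction r (f r)) (t : Fin q) {p w : ℝ} (hp : 1 ≤ p)
    (hpn : p ≤ (n : ℝ) ^ (1 / 3 : ℝ)) (hw : 1 ≤ w) :
    cubeMeasure {x | 16 * √p * w ^ 2 < |rho n q * blockSum n (I t) f x|}
      ≤ ENNReal.ofReal (8643 * Real.exp (-(p * w))) := by
  obtain ⟨A, hA, hAf⟩ := exists_isHyperbolicArray hf
  have hq1 : 1 ≤ q := Fin.pos t
  have hqn' : q ≤ n := (Nat.le_self_pow (by norm_num) q).trans hqn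
  have hn1 : 1 ≤ n := hq1.trans hqn'
  set ν : ℝ := (n : ℝ) ^ (1 / 3 : ℝ) with hν
  have hν3 : ν ^ 3 = n := by
    rw [hν, ← Real.rpow_natCast, ← Real.rpow_mul (Nat.cast_nonneg _)]; norm_num
  have hν1 : 1 ≤ ν := hp.trans hpn
  have hqν : (q : ℝ) ≤ ν := by
    refine le_of_pow_le_pow_left₀ (n := 3) (by norm_num) (by linarith) ?_
    rw [hν3]; exact_mod_cast hqn
  have hq0 : (1 : ℝ) ≤ q := by exact_mod_cast hq1
  have hn0 : (1 : ℝ) ≤ n := by exact_mod_cast hn1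
  set m : ℝ := (#(I t) : ℝ) with hm
  have hm0 : 0 ≤ m := Nat.cast_nonneg _
  have hmq : m * q ≤ 2 * ν ^ 3 := by
    rw [hν3, hm]; exact_mod_cast hI.card_mul_le hqn' t
  have hN : ((n + 1 : ℕ) : ℝ) ≤ 2 * ν ^ 3 := by rw [hν3]; push_cast; linarith
  have hN0 : (0 : ℝ) < (n + 1 : ℕ) := by positivity
  -- This makes the Azuma tail `exp (-2νw)`: one factor `exp (-νw)` pays for the union over `O(ν ^
  -- 6)` rows and pairs, the other is at most `exp (-(p * w))`.
  set L : ℝ := √(4 * (n + 1 : ℕ) * ν * w) with hL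
  have hL0 : 0 < L := Real.sqrt_pos.2 (by positivity)
  have hL2 : L ^ 2 = 4 * (n + 1 : ℕ) * ν * w := Real.sq_sqrt (by positivity)
  have hL2' : L ^ 2 ≤ 8 * ν ^ 4 * w := by
    rw [hL2]
    have := mul_le_mul_of_nonneg_right hN (by positivity : 0 ≤ 4 * ν * w)
    linarith
  have hL1 : L ≤ 3 * ν ^ 2 * w := by
    refine le_of_sq_le_sq ?_ (by positivity)
    have : ν ^ 4 * w ≤ ν ^ 4 * w * w := le_mul_of_one_le_right (by positivity) hw
    nlinarith [this, (by positivity : 0 ≤ ν ^ 4 * w)]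
  set V : ℝ := 128 * (ν ^ 6 * w ^ 2) / q with hV
  have hu0 : 0 < p * w := by positivity
  have hpw : p * w ≤ ν * w := mul_le_mul_of_nonneg_right hpn (by linarith)
  have hVle : 4 * (m * (n + 1 : ℕ)) + 8 * (p * w) * (L * m + L ^ 2) ≤ V := by
    rw [hV, le_div_iff₀ (by positivity)]
    have a1 : m * q * (n + 1 : ℕ) ≤ 2 * ν ^ 3 * (2 * ν ^ 3) :=
      mul_le_mul hmq hN hN0.le (by positivity)
    have a2 : p * w * (L * (m * q)) ≤ ν * w * (3 * ν ^ 2 * w * (2 * ν ^ 3)) :=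
      mul_le_mul hpw (mul_le_mul hL1 hmq (by positivity) (by positivity)) (by positivity)
        (by positivity)
    have a3 : p * w * (L ^ 2 * q) ≤ ν * w * (8 * ν ^ 4 * w * ν) :=
      mul_le_mul hpw (mul_le_mul hL2' hqν (by positivity) (by positivity)) (by positivity)
        (by positivity)
    have a4 : ν ^ 6 ≤ ν ^ 6 * w ^ 2 :=
      le_mul_of_one_le_right (by positivity) (one_le_pow₀ hw)
    calc (4 * (m * (n + 1 : ℕ)) + 8 * (p * w) * (L * m + L ^ 2)) * q
        = 4 * (m * q * (n + 1 : ℕ)) + 8 * (p * w * (L * (m * q))) + 8 * (p * w * (L ^ 2 * q)) := by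
          ring
      _ ≤ 4 * (2 * ν ^ 3 * (2 * ν ^ 3)) + 8 * (ν * w * (3 * ν ^ 2 * w * (2 * ν ^ 3)))
          + 8 * (ν * w * (8 * ν ^ 4 * w * ν)) := by linarith
      _ = 16 * ν ^ 6 + 112 * (ν ^ 6 * w ^ 2) := by ring
      _ ≤ 128 * (ν ^ 6 * w ^ 2) := by linarith
  obtain ⟨B, hB0, hB1, hB2⟩ := hA.exists_majorant (hI.subset_range t) hL0 hu0 hVle
  have hδ : 3 * Real.exp (-(p * w)) + (2 * m + 2 * m ^ 2) *
      Real.exp (-(L ^ 2 / (2 * (n + 1 : ℕ)))) ≤ 8643 * Real.exp (-(p * w)) := by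
    have b1 : L ^ 2 / (2 * (n + 1 : ℕ)) = ν * w + ν * w := by
      rw [hL2]; field_simp; ring
    have b2 : m ≤ 2 * ν ^ 3 := by nlinarith
    have b3 : 2 * m + 2 * m ^ 2 ≤ 12 * ν ^ 6 := by
      have c1 : m ^ 2 ≤ (2 * ν ^ 3) ^ 2 := pow_le_pow_left₀ hm0 b2 2
      have c2 : ν ^ 3 ≤ ν ^ 6 := pow_le_pow_right₀ hν1 (by norm_num)
      nlinarith
    have b4 : ν ^ 6 ≤ 720 * Real.exp (ν * w) := by
      have c1 := Real.pow_div_factorial_le_exp ν (by linarith) 6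
      have c2 : Real.exp ν ≤ Real.exp (ν * w) :=
        Real.exp_le_exp.2 (le_mul_of_one_le_right (by linarith) hw)
      norm_num [Nat.factorial] at c1
      linarith
    have b5 : Real.exp (-(ν * w)) ≤ Real.exp (-(p * w)) := Real.exp_le_exp.2 (by linarith)
    have b6 : Real.exp (ν * w) * Real.exp (-(ν * w)) = 1 := by rw [← Real.exp_add]; simp
    rw [b1, neg_add, Real.exp_add]
    calc _ ≤ 3 * Real.exp (-(p * w)) + 12 * (720 * Real.exp (ν * w)) *
          (Real.exp (-(ν * w)) * Real.exp (-(ν * w))) := by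
          have := mul_le_mul_of_nonneg_right (b3.trans (by linarith :
            12 * ν ^ 6 ≤ 12 * (720 * Real.exp (ν * w))))
            (by positivity : 0 ≤ Real.exp (-(ν * w)) * Real.exp (-(ν * w)))
          linarith
      _ = 3 * Real.exp (-(p * w)) + 8640 * (Real.exp (ν * w) * Real.exp (-(ν * w)))
          * Real.exp (-(ν * w)) := by ring
      _ ≤ _ := by rw [b6]; linarith
  refine cubeMeasure_le hB0 (hB2.trans (mul_le_mul_of_nonneg_left hδ (by positivity))) ?_
  intro x hx hxS
  refine hB1 _ _ _ ?_
  rw [← hAf _ x hx]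
  simp only [Set.mem_ofPred_eq, rho, abs_mul, abs_div, abs_of_nonneg (Real.sqrt_nonneg _),
    Nat.abs_cast] at hxS
  set F := |blockSum n (I t) f x|
  have hsq : 0 < √(q : ℝ) := Real.sqrt_pos.2 (by linarith)
  have hF : 16 * √p * w ^ 2 * n / √q < F := by
    rw [div_lt_iff₀ hsq]
    rw [div_mul_eq_mul_div, lt_div_iff₀ (by linarith)] at hxS
    linarith
  refine lt_of_le_of_lt ?_ hF
  refine Real.sqrt_le_iff.2 ⟨by positivity, ?_⟩
  rw [div_pow, Real.sq_sqrt (by linarith), mul_pow, mul_pow, mul_pow, Real.sq_sqrt (by linarith),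
    ← hν3, hV, mul_div_assoc', div_le_div_iff_of_pos_right (by linarith)]
  -- Since `2 * 128 = 16 ^ 2`, the level `√(2uV)` is `16 * √p * w ^ (3/2) * n / √q`; the power of
  -- `w` is rounded up to `2`.
  have : p * w * (ν ^ 6 * w ^ 2) ≤ p * w * (ν ^ 6 * w ^ 2) * w :=
    le_mul_of_one_le_right (by positivity) hw
  nlinarith

/-! ### From the tail bound to moments -/

lemma measurable_haar (k j : ℕ) : Measurable (haar k j) := by
  unfold haar
  exact ((measurable_const.indicator measurableSet_Ico).neg).add
    (measurable_const.indicator measurableSet_Ico)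

lemma IsRFunction.measurable {r : Fin 3 → ℕ} {f : (Fin 3 → ℝ) → ℝ} (hf : IsRFunction r f) :
    Measurable f := by
  obtain ⟨ε, -, hf⟩ := hf
  rw [funext hf]
  refine Finset.measurable_sum _ fun R _ => Measurable.const_mul ?_ _
  exact Finset.measurable_prod _ fun i _ => (measurable_haar _ _).comp (measurable_pi_apply i)

lemma measurable_blockSum {n : ℕ} {J : Finset ℕ} {f : (Fin 3 → ℕ) → (Fin 3 → ℝ) → ℝ}
    (hf : ∀ r ∈ hyperbolicVectors n, IsRFunction r (f r)) : Measurable (blockSum n J f) := by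
  unfold blockSum
  exact Finset.measurable_sum _ fun r hr => (hf r (Finset.mem_filter.1 hr).1).measurable

lemma cubeMeasure_univ : cubeMeasure Set.univ = 1 := by
  rw [cubeMeasure, Measure.restrict_apply_univ, Real.volume_Icc_pi]
  simp

instance : IsProbabilityMeasure cubeMeasure := ⟨cubeMeasure_univ⟩

lemma summable_exp_half : Summable fun w : ℕ => Real.exp (-(((w : ℝ) + 1) / 2)) := by
  have h := (summable_geometric_of_lt_one (Real.exp_pos (-(1 / 2 : ℝ))).le
    (Real.exp_lt_one_iff.2 (by norm_num))).mul_left (Real.exp (-(1 / 2 : ℝ)))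
  refine h.congr fun w => ?_
  rw [← Real.exp_nat_mul, ← Real.exp_add]
  congr 1
  ring

/-- A function on a probability space with tails `e^{-p w}` at the levels `a w ^ 2` has `L^p` norm
at most a multiple of `a`. -/
theorem eLpNorm_le_of_tail {α : Type*} [MeasurableSpace α] {P : Measure α}
    [IsProbabilityMeasure P] {g : α → ℝ} (hg : Measurable g) {a p C : ℝ} (ha : 0 < a) (hp : 1 ≤ p)
    (hC : 0 ≤ C) (h : ∀ w : ℝ, 1 ≤ w →
      P {x | a * w ^ 2 < |g x|} ≤ ENNReal.ofReal (C * Real.exp (-(p * w)))) :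
    eLpNorm g (ENNReal.ofReal p) P ≤ ENNReal.ofReal
      (16 * (1 + C * ∑' w : ℕ, Real.exp (-(((w : ℝ) + 1) / 2))) * a) := by
  set S := ∑' w : ℕ, Real.exp (-(((w : ℝ) + 1) / 2)) with hS
  have hS0 : 0 ≤ S := tsum_nonneg fun w => (Real.exp_pos _).le
  have hp0 : 0 < p := by linarith
  rw [eLpNorm_eq_lintegral_rpow_enorm_toReal (by simpa using hp0) ENNReal.ofReal_ne_top,
    ENNReal.toReal_ofReal hp0.le]
  set E : ℕ → Set α := fun w => {x | a * ((w : ℝ) + 1) ^ 2 < |g x|} with hE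
  have hEm : ∀ w, MeasurableSet (E w) := fun w =>
    measurableSet_lt measurable_const hg.abs
  have point : ∀ x, ‖g x‖ₑ ^ p ≤ ENNReal.ofReal (a ^ p) + ∑' w : ℕ, (E w).indicator
      (fun _ => ENNReal.ofReal ((a * ((w : ℝ) + 2) ^ 2) ^ p)) x := by
    intro x
    rw [Real.enorm_eq_ofReal_abs, ENNReal.ofReal_rpow_of_nonneg (abs_nonneg _) hp0.le]
    have hex : ∃ k : ℕ, |g x| ≤ a * ((k : ℝ) + 1) ^ 2 := by
      obtain ⟨k, hk⟩ := exists_nat_ge (|g x| / a)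
      refine ⟨k, ?_⟩
      rw [div_le_iff₀ ha] at hk
      nlinarith [mul_nonneg ha.le (Nat.cast_nonneg k : (0 : ℝ) ≤ k),
        mul_nonneg ha.le (sq_nonneg (k : ℝ))]
    -- Shells by the least admissible `k`: for `k = 0` the constant `a ^ p` suffices; for `k = w +
    -- 1` minimality puts `x` in `E w`.
    classical
    rcases hk : Nat.find hex with _ | w
    · have h1 := Nat.find_spec hex
      rw [hk] at h1
      refine le_add_right (ENNReal.ofReal_le_ofReal (Real.rpow_le_rpow (abs_nonneg _) ?_ hp0.le))
      simpa using h1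
    · have h1 := Nat.find_spec hex
      have h2 := Nat.find_min hex (m := w) (by omega)
      rw [hk] at h1
      refine le_add_left (le_trans ?_ (ENNReal.le_tsum w))
      rw [Set.indicator_of_mem (show x ∈ E w from not_le.1 h2)]
      refine ENNReal.ofReal_le_ofReal (Real.rpow_le_rpow (abs_nonneg _) ?_ hp0.le)
      push_cast at h1
      rwa [show (w : ℝ) + 1 + 1 = w + 2 by ring] at h1
  have term : ∀ w : ℕ, ENNReal.ofReal ((a * ((w : ℝ) + 2) ^ 2) ^ p) * P (E w)
      ≤ ENNReal.ofReal ((16 * a) ^ p * C * Real.exp (-(((w : ℝ) + 1) / 2))) := by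
    intro w
    have hw : (0 : ℝ) ≤ w := Nat.cast_nonneg w
    refine (mul_le_mul_right (h ((w : ℝ) + 1) (by linarith)) _).trans ?_
    rw [← ENNReal.ofReal_mul (by positivity)]
    refine ENNReal.ofReal_le_ofReal ?_
    -- Half of the tail exponent absorbs the polynomial level; as `p ≥ 1`, the other half leaves a
    -- summable series independent of `p`.
    have c1 : ((w : ℝ) + 2) ^ 2 ≤ 16 * Real.exp (((w : ℝ) + 1) / 2) := by
      have := Real.quadratic_le_exp_of_nonneg (x := ((w : ℝ) + 1) / 2) (by positivity)
      nlinarith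
    have c2 : (a * ((w : ℝ) + 2) ^ 2) ^ p
        ≤ (16 * a) ^ p * Real.exp (p * (((w : ℝ) + 1) / 2)) := by
      rw [mul_comm p, Real.exp_mul, ← Real.mul_rpow (by positivity) (by positivity)]
      refine Real.rpow_le_rpow (by positivity) ?_ hp0.le
      nlinarith
    have c3 : Real.exp (p * (((w : ℝ) + 1) / 2)) * Real.exp (-(p * ((w : ℝ) + 1)))
        ≤ Real.exp (-(((w : ℝ) + 1) / 2)) := by
      rw [← Real.exp_add]
      refine Real.exp_le_exp.2 ?_
      nlinarith
    calc _ ≤ (16 * a) ^ p * Real.exp (p * (((w : ℝ) + 1) / 2)) *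
          (C * Real.exp (-(p * ((w : ℝ) + 1)))) :=
          mul_le_mul_of_nonneg_right c2 (by positivity)
      _ = (16 * a) ^ p * C * (Real.exp (p * (((w : ℝ) + 1) / 2)) *
          Real.exp (-(p * ((w : ℝ) + 1)))) := by ring
      _ ≤ _ := mul_le_mul_of_nonneg_left c3 (by positivity)
  have int : ∫⁻ x, ‖g x‖ₑ ^ p ∂P ≤ ENNReal.ofReal ((16 * (1 + C * S) * a) ^ p) := by
    calc ∫⁻ x, ‖g x‖ₑ ^ p ∂P
        ≤ ∫⁻ x, (ENNReal.ofReal (a ^ p) + ∑' w : ℕ, (E w).indicator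
            (fun _ => ENNReal.ofReal ((a * ((w : ℝ) + 2) ^ 2) ^ p)) x) ∂P := lintegral_mono point
      _ = ENNReal.ofReal (a ^ p) + ∑' w : ℕ,
            ENNReal.ofReal ((a * ((w : ℝ) + 2) ^ 2) ^ p) * P (E w) := by
          rw [lintegral_add_left measurable_const, lintegral_const, measure_univ, mul_one,
            lintegral_tsum fun w => (measurable_const.indicator (hEm w)).aemeasurable]
          congr 1
          exact tsum_congr fun w => lintegral_indicator_const (hEm w) _
      _ ≤ ENNReal.ofReal (a ^ p) + ∑' w : ℕ,
            ENNReal.ofReal ((16 * a) ^ p * C * Real.exp (-(((w : ℝ) + 1) / 2))) :=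
          add_le_add le_rfl (ENNReal.tsum_le_tsum term)
      _ = ENNReal.ofReal (a ^ p + (16 * a) ^ p * C * S) := by
          rw [← ENNReal.ofReal_tsum_of_nonneg (fun w => by positivity)
            (summable_exp_half.mul_left _), tsum_mul_left, ← ENNReal.ofReal_add (by positivity)
            (by positivity)]
      _ ≤ _ := by
          refine ENNReal.ofReal_le_ofReal ?_
          have d1 : a ^ p ≤ (16 * a) ^ p := Real.rpow_le_rpow ha.le (by linarith) hp0.le
          have d2 : 1 + C * S ≤ (1 + C * S) ^ p :=
            Real.self_le_rpow_of_one_le (by nlinarith [mul_nonneg hC hS0]) hp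
          rw [show 16 * (1 + C * S) * a = 16 * a * (1 + C * S) by ring,
            Real.mul_rpow (x := 16 * a) (y := 1 + C * S) (by positivity) (by positivity)]
          calc _ ≤ (16 * a) ^ p * (1 + C * S) := by linarith
            _ ≤ _ := mul_le_mul_of_nonneg_left d2 (by positivity)
  calc _ ≤ (ENNReal.ofReal ((16 * (1 + C * S) * a) ^ p)) ^ (1 / p) :=
        ENNReal.rpow_le_rpow int (by positivity)
    _ = _ := by
        rw [ENNReal.ofReal_rpow_of_nonneg (by positivity) (by positivity),
          ← Real.rpow_mul (by positivity), mul_one_div_cancel hp0.ne', Real.rpow_one]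

end Hyperbolic

end

theorem mainTheorem4 :
    ∃ c K : ℝ, 0 < c ∧ c < 1 ∧ 0 < K ∧
      ∀ (n q : ℕ), q ^ 3 ≤ n →
      ∀ (I : Fin q → Finset ℕ), Hyperbolic.IsIntervalPartition n q I →
      ∀ (f : (Fin 3 → ℕ) → (Fin 3 → ℝ) → ℝ),
        (∀ r ∈ Hyperbolic.hyperbolicVectors n, Hyperbolic.IsRFunction r (f r)) →
      ∀ t : Fin q,
        (∀ p : ℝ, 1 ≤ p → p ≤ c * (n : ℝ) ^ (1 / 3 : ℝ) →
          MeasureTheory.eLpNorm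
              (fun x => Hyperbolic.rho n q * Hyperbolic.blockSum n (I t) f x)
              (ENNReal.ofReal p) Hyperbolic.cubeMeasure
            ≤ ENNReal.ofReal (K * Real.sqrt p)) ∧
        (∀ y : ℝ, 0 ≤ y → y < c * (n : ℝ) ^ (1 / 6 : ℝ) →
          Hyperbolic.cubeMeasure
              {x | y < Hyperbolic.rho n q * Hyperbolic.blockSum n (I t) f x}
            ≤ ENNReal.ofReal (K * Real.exp (-c * y ^ 2))) := by
  set S := ∑' w : ℕ, Real.exp (-(((w : ℝ) + 1) / 2)) with hS
  have hS0 : 0 ≤ S := tsum_nonneg fun w => (Real.exp_pos _).le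
  -- `1 / 256 = 1 / 16 ^ 2` comes from solving `y = 16 * √p` for `p`. The first summand of `K` is
  -- the moment constant, the second the tail constant.
  refine ⟨1 / 256, 16 * (1 + 8643 * S) * 16 + 8643, by norm_num, by norm_num, by positivity, ?_⟩
  intro n q hqn I hI f hf t
  refine ⟨fun p hp hpn => ?_, fun y hy hyn => ?_⟩
  · have hpn' : p ≤ (n : ℝ) ^ (1 / 3 : ℝ) := by
      have : (0 : ℝ) ≤ (n : ℝ) ^ (1 / 3 : ℝ) := by positivity
      linarith
    have hsp : 0 < √p := Real.sqrt_pos.2 (by linarith)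
    refine (Hyperbolic.eLpNorm_le_of_tail (a := 16 * √p)
      ((Hyperbolic.measurable_blockSum hf).const_mul _) (by positivity) hp
      (by norm_num : (0 : ℝ) ≤ 8643) fun w hw =>
        Hyperbolic.cubeMeasure_lt_abs_blockSum_le hqn hI hf t hp hpn' hw).trans ?_
    refine ENNReal.ofReal_le_ofReal ?_
    rw [← hS]
    nlinarith
  · by_cases hy1 : y < 16
    · refine prob_le_one.trans ?_
      rw [← ENNReal.ofReal_one]
      refine ENNReal.ofReal_le_ofReal ?_
      have h1 : Real.exp (-1) ≤ Real.exp (-(1 / 256) * y ^ 2) :=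
        Real.exp_le_exp.2 (by nlinarith)
      have h2 : (1 : ℝ) / 3 ≤ Real.exp (-1) := by
        rw [Real.exp_neg, ← one_div]
        exact one_div_le_one_div_of_le (Real.exp_pos _) (by linarith [Real.exp_one_lt_d9])
      nlinarith [mul_nonneg hS0 (Real.exp_pos (-(1 / 256) * y ^ 2)).le]
    · push Not at hy1
      set p : ℝ := y ^ 2 / 256 with hp
      have hp1 : 1 ≤ p := by rw [hp]; nlinarith
      have h6 : ((n : ℝ) ^ (1 / 6 : ℝ)) ^ 2 = (n : ℝ) ^ (1 / 3 : ℝ) := by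
        rw [← Real.rpow_natCast, ← Real.rpow_mul (Nat.cast_nonneg _)]; norm_num
      have hpn : p ≤ (n : ℝ) ^ (1 / 3 : ℝ) := by
        rw [← h6, hp]
        have : (0 : ℝ) ≤ (n : ℝ) ^ (1 / 6 : ℝ) := by positivity
        nlinarith
      have hsp : 16 * √p = y := by
        rw [hp, show y ^ 2 / 256 = (y / 16) ^ 2 by ring, Real.sqrt_sq (by positivity)]; ring
      -- The level `w = 1` with `p = y ^ 2 / 256`; the range `y < c n^{1/6}` guarantees `p ≤
      -- n^{1/3}`.
      refine (measure_mono ?_).trans ((Hyperbolic.cubeMeasure_lt_abs_blockSum_le hqn hI hf t hp1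
        hpn le_rfl).trans (ENNReal.ofReal_le_ofReal ?_))
      · intro x hx
        simp only [Set.mem_ofPred_eq, one_pow, mul_one, hsp] at hx ⊢
        exact hx.trans_le (le_abs_self _)
      · rw [show -(p * 1) = -(1 / 256) * y ^ 2 by rw [hp]; ring]
        refine mul_le_mul_of_nonneg_right ?_ (Real.exp_pos _).le
        nlinarith
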